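/- \textbf{Theorem (Strict saddle property).} Let $p,q,r\ge 0$ be integers, let $\lambda>0$, and let $f:\mathbb{R}^{p\times q}\to\mathbb{R}$ be twice continuously differentiable and $(2r,4r)$-restricted well-conditioned, i.e. there are constants $m>0$ and $M$ with $M/m\le 1.5$ such that \[ m\|D\|_F^2\le[\nabla^2 f(X)](D,D)\le M\|D\|_F^2\quad\text{whenever }\operatorname{rank}(X)\le 2r\text{ and }\operatorname{rank}(D)\le 4r. \] Let $X^\star$ be a global minimizer of $f(X)+\lambda\|X\|_*$ over $X\in\mathbb{R}^{p\times q}$, where $\|X\|_*$ is the nuclear norm (the sum of the singular values), let $r^\star=\operatorname{rank}(X^\star)$, and assume $r\ge r^\star$. For $U\in\mathbb{R}^{p\times r}$, $V\in\mathbb{R}^{q\times r}$ and $W=\begin{bmatrix}U\\V\end{bmatrix}$ put \[ g(W)=g(U,V)=f(UV^T)+\tfrac{\lambda}{2}\left(\|U\|_F^2+\|V\|_F^2\right). \] Let $(U,V)$ be any critical point of $g$, i.e. $\nabla g(U,V)=0$. Then either $UV^T=X^\star$, or $W$ is a strict saddle of $g$, i.e. $\lambda_{\min}(\nabla^2 g(W))<0$;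 and in the latter case, where $UV^T\ne X^\star$, \[ \lambda_{\min}(\nabla^2 g(W))\le -0.12\,m\,\min\{0.5\,\rho(W)^2,\rho(X^\star)\}, \] if moreover $r=r^\star$, then \[ \lambda_{\min}(\nabla^2 g(W))\le -0.099\,m\,\rho(X^\star), \] and if moreover $W=0$, then \[ \lambda_{\min}(\nabla^2 g(W))\le -0.12\,m\,\rho(X^\star). \] Here $\lambda_{\min}$ is the smallest eigenvalue of the Hessian matrix of $g$, and $\rho(A)$ is the smallest nonzero singular value of the matrix $A$, with $\rho(0)=0$. -/

import Mathlib

open scoped Matrix Matrix.Norms.Frobenius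

noncomputable section

namespace LowRank

variable {m n : Type*} [Fintype m] [Fintype n] [DecidableEq m] [DecidableEq n]

/-- The singular values of a real matrix (decreasing, repeated with multiplicity, then padded by
zeros): those of the linear map that it defines between Euclidean spaces. -/
def singularValue (A : Matrix m n ℝ) (i : ℕ) : ℝ :=
  (Matrix.toEuclideanLin A).singularValues i

/-- The nuclear norm: the sum of the singular values. -/
def nuclearNorm (A : Matrix m n ℝ) : ℝ :=
  ∑ i ∈ Finset.range (Fintype.card n), singularValue A i

/-- The smallest nonzero singular value of a matrix (with the value `0` for the zero matrix). -/
def rho (A : Matrix m n ℝ) : ℝ :=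
  sInf {s : ℝ | 0 < s ∧ ∃ i : ℕ, singularValue A i = s}

/-- The second derivative of `ψ` at `x`, as a bilinear form evaluated at the directions
`v` and `w`. -/
def hessianForm {E : Type*} [NormedAddCommGroup E] [NormedSpace ℝ E] (ψ : E → ℝ) (x v w : E) :
    ℝ :=
  fderiv ℝ (fderiv ℝ ψ) x v w

/-- The Hessian matrix, formed by the second partial derivatives of `ψ` with respect to the
entries of the matrix variable. -/
def hessianMatrix (ψ : Matrix m n ℝ → ℝ) (X : Matrix m n ℝ) : Matrix (m × n) (m × n) ℝ :=
  Matrix.of fun a b =>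
    hessianForm ψ X (Matrix.single a.1 a.2 (1 : ℝ)) (Matrix.single b.1 b.2 (1 : ℝ))

/-- The smallest eigenvalue of a (symmetric) real matrix. -/
def lambdaMin (A : Matrix m m ℝ) : ℝ :=
  sInf {μ : ℝ | Module.End.HasEigenvalue (Matrix.toLin' A) μ}

/-- `x` is a critical point of `ψ`: `ψ` is differentiable at `x` with derivative zero. -/
def IsCriticalPoint {E : Type*} [NormedAddCommGroup E] [NormedSpace ℝ E] (ψ : E → ℝ) (x : E) :
    Prop :=
  HasFDerivAt ψ (0 : E →L[ℝ] ℝ) x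

/-- A strict saddle: a critical point at which the smallest eigenvalue of the Hessian is
negative. -/
def IsStrictSaddle (ψ : Matrix m n ℝ → ℝ) (X : Matrix m n ℝ) : Prop :=
  IsCriticalPoint ψ X ∧ lambdaMin (hessianMatrix ψ X) < 0

/-- The `(2r, 4r)`-restricted well-conditionedness with constants `c` (lower, positive) and
`C` (upper) such that `C / c ≤ 1.5`. Here `‖D‖` is the Frobenius norm. -/
def RestrictedWellConditioned (f : Matrix m n ℝ → ℝ) (r : ℕ) (c C : ℝ) : Prop :=
  0 < c ∧ C / c ≤ 1.5 ∧
    ∀ X D : Matrix m n ℝ, X.rank ≤ 2 * r → D.rank ≤ 4 * r →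
      c * ‖D‖ ^ 2 ≤ hessianForm f X D D ∧ hessianForm f X D D ≤ C * ‖D‖ ^ 2

/-- The factored objective `g(U, V) = f(U Vᵀ) + lam (‖U‖² + ‖V‖²) / 2` (Frobenius norms), as a
function of the stacked variable `W = [U; V]`. -/
def factored {p q r : ℕ} (f : Matrix (Fin p) (Fin q) ℝ → ℝ) (lam : ℝ)
    (W : Matrix (Fin p ⊕ Fin q) (Fin r) ℝ) : ℝ :=
  f (W.toRows₁ * W.toRows₂ᵀ) + lam * ((‖W.toRows₁‖ ^ 2 + ‖W.toRows₂‖ ^ 2) / 2)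

end LowRank

end

/-! Stack the factors as `C = [U; V]`, let `D` stack a balanced factorization of the minimizer `X⋆`,
rotated so that `CᵀD` is positive semidefinite, and put `L = UVᵀ - X⋆`. If `L ≠ 0`, then `C - D` is
a direction of negative curvature, with value at most `-0.47 m ‖L‖²`
(`hessianForm_factored_sub_le`).

The part of this curvature that does not involve `∇²f` is at most `-2⟨∇f(UVᵀ) - ∇f(X⋆), L⟩ ≤
-2m‖L‖²`, by criticality of both pairs of factors and the bound `lam` on the operator norm of
`∇f(X⋆)`. The `∇²f` part is at most `1.5 m ‖C(C - D)ᵀ‖²`, so it suffices that `‖C(C - D)ᵀ‖² ≤ 1.02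
‖L‖²`. By `sub_mul_transpose_le_projection` the left side is at most `1/8 ‖CCᵀ - DDᵀ‖²`, where `‖CCᵀ
- DDᵀ‖² ≤ 4‖L‖²`, plus `13/4` times the squared norm of `CCᵀ - DDᵀ` projected onto the range of `C`.
The projection is small, at most `4/25 ‖L‖²`: it corresponds to a direction `H` against which the
gradient difference pairs nonpositively, while good conditioning makes that pairing nearly a
multiple of `⟨L, H⟩`.

The Rayleigh quotient then gives `λ_min ‖C - D‖² ≤ -(0.47/4) m ‖CCᵀ - DDᵀ‖²`. It remains to bound
`‖CCᵀ - DDᵀ‖²` below by `‖C - D‖²`: through `mul_ip_sub_le_gram_sub` in general, and through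
`sub_mul_transpose_le_gram_sub` when `r = r⋆`. -/

noncomputable section

namespace LowRank

/-! ### Frobenius inner product -/

section InnerProduct

variable {m n k l : Type*} [Fintype m] [Fintype n] [Fintype k] [Fintype l]

/-- The Frobenius inner product of two real matrices. -/
def ip (A B : Matrix m n ℝ) : ℝ := (Aᵀ * B).trace

theorem ip_eq_sum (A B : Matrix m n ℝ) : ip A B = ∑ i, ∑ j, A i j * B i j := by
  rw [Finset.sum_comm]
  simp [ip, Matrix.trace, Matrix.mul_apply]

theorem ip_comm (A B : Matrix m n ℝ) : ip A B = ip B A := by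
  simp [ip_eq_sum, mul_comm]

@[simp] theorem ip_add_left (A B C : Matrix m n ℝ) : ip (A + B) C = ip A C + ip B C := by
  simp [ip, Matrix.add_mul]

@[simp] theorem ip_add_right (A B C : Matrix m n ℝ) : ip A (B + C) = ip A B + ip A C := by
  simp [ip, Matrix.mul_add]

@[simp] theorem ip_sub_left (A B C : Matrix m n ℝ) : ip (A - B) C = ip A C - ip B C := by
  simp [ip, Matrix.sub_mul]

@[simp] theorem ip_sub_right (A B C : Matrix m n ℝ) : ip A (B - C) = ip A B - ip A C := by
  simp [ip, Matrix.mul_sub]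

@[simp] theorem ip_smul_left (c : ℝ) (A B : Matrix m n ℝ) : ip (c • A) B = c * ip A B := by
  simp [ip]

@[simp] theorem ip_smul_right (c : ℝ) (A B : Matrix m n ℝ) : ip A (c • B) = c * ip A B := by
  simp [ip]

@[simp] theorem ip_neg_left (A B : Matrix m n ℝ) : ip (-A) B = -ip A B := by
  simp [ip]

@[simp] theorem ip_neg_right (A B : Matrix m n ℝ) : ip A (-B) = -ip A B := by
  simp [ip]

@[simp] theorem ip_zero_left (A : Matrix m n ℝ) : ip 0 A = 0 := by simp [ip]

@[simp] theorem ip_zero_right (A : Matrix m n ℝ) : ip A 0 = 0 := by simp [ip]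

theorem ip_transpose (A B : Matrix m n ℝ) : ip Aᵀ Bᵀ = ip A B := by
  rw [ip_eq_sum, ip_eq_sum, Finset.sum_comm]; rfl

theorem ip_mul_left (A : Matrix m k ℝ) (B : Matrix k n ℝ) (C : Matrix m n ℝ) :
    ip (A * B) C = ip B (Aᵀ * C) := by
  simp [ip, Matrix.transpose_mul, Matrix.mul_assoc]

theorem ip_mul_right (A : Matrix m k ℝ) (B : Matrix k n ℝ) (C : Matrix m n ℝ) :
    ip (A * B) C = ip A (C * Bᵀ) := by
  rw [ip, ip, Matrix.transpose_mul, Matrix.mul_assoc, Matrix.trace_mul_comm, Matrix.mul_assoc]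

theorem ip_self_nonneg (A : Matrix m n ℝ) : 0 ≤ ip A A := by
  rw [ip_eq_sum]
  exact Finset.sum_nonneg fun i _ => Finset.sum_nonneg fun j _ => mul_self_nonneg _

theorem ip_self_eq_zero {A : Matrix m n ℝ} : ip A A = 0 ↔ A = 0 := by
  refine ⟨fun h => ?_, fun h => by simp [h]⟩
  rw [ip_eq_sum] at h
  ext i j
  have h1 := (Finset.sum_eq_zero_iff_of_nonneg
    (fun i _ => Finset.sum_nonneg fun j _ => mul_self_nonneg (A i j))).1 h i (Finset.mem_univ _)
  have h2 := (Finset.sum_eq_zero_iff_of_nonneg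
    (fun j _ => mul_self_nonneg (A i j))).1 h1 j (Finset.mem_univ _)
  simpa using h2

theorem ip_self_pos {A : Matrix m n ℝ} (h : A ≠ 0) : 0 < ip A A :=
  lt_of_le_of_ne (ip_self_nonneg A) fun h0 => h (ip_self_eq_zero.1 h0.symm)

theorem norm_sq_eq_ip (A : Matrix m n ℝ) : ‖A‖ ^ 2 = ip A A := by
  rw [Matrix.frobenius_norm_def, ip_eq_sum, ← Real.sqrt_eq_rpow, Real.sq_sqrt]
  · simp [← pow_two]
  · positivity

/-- Reduces norms of outer products to pairings of small Gram matrices, where the later estimates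
take place. -/
theorem ip_mul_mul_transpose (A : Matrix m k ℝ) (B : Matrix n k ℝ) (C : Matrix m l ℝ)
    (D : Matrix n l ℝ) : ip (A * Bᵀ) (C * Dᵀ) = ip (Aᵀ * C) (Bᵀ * D) := by
  rw [ip_mul_left, ← Matrix.mul_assoc, ip_comm, ip_mul_right, Matrix.transpose_transpose,
    ← ip_transpose, Matrix.transpose_mul Bᵀ, Matrix.transpose_transpose,
    ← ip_transpose, Matrix.transpose_transpose, Matrix.transpose_mul, Matrix.transpose_transpose]

theorem two_mul_ip_le (A B : Matrix m n ℝ) : 2 * ip A B ≤ ip A A + ip B B := by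
  have h := ip_self_nonneg (A - B)
  simp only [ip_sub_left, ip_sub_right, ip_comm B A] at h
  linarith

/-- A matrix whose Gram matrix is an orthogonal projection is a contraction. -/
theorem ip_mul_self_le {Q : Matrix m k ℝ} {E : Matrix k k ℝ} (hQ : Qᵀ * Q = E)
    (hE : Eᵀ = E) (hE2 : E * E = E) (M : Matrix k n ℝ) : ip (Q * M) (Q * M) ≤ ip M M := by
  have h := ip_self_nonneg (M - E * M)
  have h1 : ip (E * M) (E * M) = ip M (E * M) := by
    rw [ip_mul_left, hE, ← Matrix.mul_assoc, hE2]
  simp only [ip_sub_left, ip_sub_right, ip_comm (E * M) M, h1] at h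
  rw [ip_mul_left, ← Matrix.mul_assoc, hQ]
  linarith

/-- Bessel's inequality. -/
theorem ip_transpose_mul_self_le {Q : Matrix m k ℝ} {E : Matrix k k ℝ} (hQ : Qᵀ * Q = E)
    (hE : Eᵀ = E) (hE2 : E * E = E) (M : Matrix m n ℝ) :
    ip (Qᵀ * M) (Qᵀ * M) ≤ ip M M := by
  have h := ip_self_nonneg (M - Q * (Qᵀ * M))
  have h1 := ip_mul_self_le hQ hE hE2 (Qᵀ * M)
  have h2 : ip (Q * (Qᵀ * M)) M = ip (Qᵀ * M) (Qᵀ * M) := by rw [ip_mul_left]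
  simp only [ip_sub_left, ip_sub_right, ip_comm M, h2] at h
  linarith

end InnerProduct

/-! ### Aligned factors against differences of Gram matrices -/

section Alignment

variable {ι κ : Type*} [Fintype ι] [Fintype κ]

theorem ip_gram_sub (C D : Matrix ι κ ℝ) :
    ip (C * Cᵀ - D * Dᵀ) (C * Cᵀ - D * Dᵀ) =
      ip (Cᵀ * C) (Cᵀ * C) + ip (Dᵀ * D) (Dᵀ * D) - 2 * ip (Cᵀ * D) (Cᵀ * D) := by
  simp only [ip_sub_left, ip_sub_right, ip_comm (D * Dᵀ) (C * Cᵀ), ip_mul_mul_transpose]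
  ring

/-- Alignment enters through the symmetry of `CᵀD` and through `⟨CᵀD, (C - D)ᵀ(C - D)⟩ ≥ 0`; the
rest is completing a square. -/
theorem sub_mul_transpose_le_gram_sub {ν : Type*} [Fintype ν] (C D : Matrix ι κ ℝ)
    (T : Matrix ν κ ℝ) (h : Cᵀ * D = Tᵀ * T) :
    4 / 5 * ip (C * (C - D)ᵀ) (C * (C - D)ᵀ) ≤ ip (C * Cᵀ - D * Dᵀ) (C * Cᵀ - D * Dᵀ) := by
  have hs : Dᵀ * C = Cᵀ * D := by
    have := congrArg Matrix.transpose h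
    simp only [Matrix.transpose_mul, Matrix.transpose_transpose] at this
    rw [this, h]
  have e1 := ip_gram_sub C D
  have e2 : ip (C * (C - D)ᵀ) (C * (C - D)ᵀ) = ip (Cᵀ * C) ((C - D)ᵀ * (C - D)) :=
    ip_mul_mul_transpose _ _ _ _
  have e3 : 0 ≤ ip (Tᵀ * T) ((C - D)ᵀ * (C - D)) := by
    rw [← ip_mul_mul_transpose]; exact ip_self_nonneg _
  rw [← h] at e3
  have hh : (C - D)ᵀ * (C - D) = Cᵀ * C + Dᵀ * D - (2 : ℝ) • (Cᵀ * D) := by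
    rw [Matrix.transpose_sub, Matrix.sub_mul, Matrix.mul_sub, Matrix.mul_sub, hs, two_smul]
    abel
  rw [hh] at e2 e3
  rw [e1, e2]
  generalize Cᵀ * C = a at *
  generalize Dᵀ * D = b at *
  generalize Cᵀ * D = s at *
  -- With `h = a + b - 2s` and `x = a - s`, the right side minus the left is `‖h - 7/5 x‖² + 1/25
  -- ‖x‖² + 6/5 ⟨s, h⟩`.
  have e4 := ip_self_nonneg (a + b - (2 : ℝ) • s - (7 / 5 : ℝ) • (a - s))
  have e5 := ip_self_nonneg (a - s)
  simp only [ip_sub_left, ip_sub_right, ip_add_left, ip_add_right, ip_smul_left, ip_smul_right,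
    ip_comm b a, ip_comm s a, ip_comm s b] at *
  linarith

/-- Split `D` into `D₁ = PD` and `D₂ ⟂ D₁, C`. All cross terms vanish, and the component of the Gram
difference outside the range of `P`, which is not known to be small, enters only with weight `1/8`.
-/
theorem sub_mul_transpose_le_projection {ν : Type*} [Fintype ν] (C D : Matrix ι κ ℝ)
    (T : Matrix ν κ ℝ) (h : Cᵀ * D = Tᵀ * T) (P : Matrix ι ι ℝ) (hP : Pᵀ = P) (hPP : P * P = P)
    (hPC : P * C = C) :
    ip (C * (C - D)ᵀ) (C * (C - D)ᵀ) ≤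
      1 / 8 * ip (C * Cᵀ - D * Dᵀ) (C * Cᵀ - D * Dᵀ) +
        13 / 4 * ip ((C * Cᵀ - D * Dᵀ) * P) ((C * Cᵀ - D * Dᵀ) * P) := by
  obtain ⟨D₁, hD₁⟩ : ∃ D₁, D₁ = P * D := ⟨_, rfl⟩
  obtain ⟨D₂, hD₂⟩ : ∃ D₂, D₂ = D - D₁ := ⟨_, rfl⟩
  have hD : D = D₁ + D₂ := by rw [hD₂]; abel
  have hPD₁ : P * D₁ = D₁ := by rw [hD₁, ← Matrix.mul_assoc, hPP]
  have hPD₂ : P * D₂ = 0 := by rw [hD₂, Matrix.mul_sub, hPD₁, ← hD₁, sub_self]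
  have hort : ∀ M : Matrix ι κ ℝ, P * M = M → Mᵀ * D₂ = 0 := by
    intro M hM
    rw [← hM, Matrix.transpose_mul, hP, Matrix.mul_assoc, hPD₂, Matrix.mul_zero]
  have o1 := hort C hPC
  have o2 := hort D₁ hPD₁
  have o1' : D₂ᵀ * C = 0 := by simpa using congrArg Matrix.transpose o1
  have o2' : D₂ᵀ * D₁ = 0 := by simpa using congrArg Matrix.transpose o2
  have hPt : ∀ M : Matrix ι κ ℝ, Mᵀ * P = (P * M)ᵀ := by
    intro M; rw [Matrix.transpose_mul, hP]
  have hS : Cᵀ * D₁ = Tᵀ * T := by rw [← h, hD, Matrix.mul_add, o1, add_zero]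
  have hs : D₁ᵀ * C = Cᵀ * D₁ := by
    have := congrArg Matrix.transpose hS
    simp only [Matrix.transpose_mul, Matrix.transpose_transpose] at this
    rw [this, hS]
  have b1 := sub_mul_transpose_le_gram_sub C D₁ T hS
  -- Symmetry of `CᵀD₁` gives `‖CᵀD₁‖² = ⟨CD₁ᵀ, D₁Cᵀ⟩ ≤ ‖CD₁ᵀ‖²`.
  have b2 : ip (Cᵀ * C - D₁ᵀ * D₁) (Cᵀ * C - D₁ᵀ * D₁) ≤
      ip (C * Cᵀ - D₁ * D₁ᵀ) (C * Cᵀ - D₁ * D₁ᵀ) := by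
    have e := ip_gram_sub C D₁
    have e' := ip_gram_sub Cᵀ D₁ᵀ
    simp only [Matrix.transpose_transpose] at e'
    have e'' : ip (Cᵀ * D₁) (Cᵀ * D₁) ≤ ip (C * D₁ᵀ) (C * D₁ᵀ) := by
      have e3 := two_mul_ip_le (C * D₁ᵀ) (D₁ * Cᵀ)
      have e4 : ip (D₁ * Cᵀ) (D₁ * Cᵀ) = ip (C * D₁ᵀ) (C * D₁ᵀ) := by
        rw [← ip_transpose (C * D₁ᵀ), Matrix.transpose_mul, Matrix.transpose_transpose]
      rw [ip_mul_mul_transpose C D₁, hs, e4] at e3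
      linarith
    have e5 : ip (C * Cᵀ) (C * Cᵀ) = ip (Cᵀ * C) (Cᵀ * C) := ip_mul_mul_transpose _ _ _ _
    have e6 : ip (D₁ * D₁ᵀ) (D₁ * D₁ᵀ) = ip (D₁ᵀ * D₁) (D₁ᵀ * D₁) := ip_mul_mul_transpose _ _ _ _
    linarith
  -- Young's inequality with weights `1/8` and `2`; the constant `13/4` is this `2` plus the `5/4`
  -- from `b1`.
  have b3 := ip_self_nonneg ((1 / 2 : ℝ) • (D₂ᵀ * D₂) - (2 : ℝ) • (Cᵀ * C - D₁ᵀ * D₁))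
  have hY : C * Cᵀ - D * Dᵀ = (C * Cᵀ - D₁ * D₁ᵀ) - D₁ * D₂ᵀ - D₂ * D₁ᵀ - D₂ * D₂ᵀ := by
    rw [hD, Matrix.transpose_add, Matrix.add_mul, Matrix.mul_add, Matrix.mul_add]; abel
  have hYP : (C * Cᵀ - D * Dᵀ) * P = (C * Cᵀ - D₁ * D₁ᵀ) - D₂ * D₁ᵀ := by
    rw [hY]
    simp only [Matrix.sub_mul, Matrix.mul_assoc, hPt, hPC, hPD₁, hPD₂]
    simp
  have hL : C * (C - D)ᵀ = C * (C - D₁)ᵀ - C * D₂ᵀ := by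
    rw [← Matrix.mul_sub, ← Matrix.transpose_sub, hD]; congr 2; abel
  rw [hYP, hY, hL]
  have c0 : ip (D₂ * D₁ᵀ) (D₂ * D₁ᵀ) = ip (D₁ * D₂ᵀ) (D₁ * D₂ᵀ) := by
    rw [← ip_transpose (D₁ * D₂ᵀ), Matrix.transpose_mul, Matrix.transpose_transpose]
  have c1 : (C - D₁)ᵀ * D₂ = 0 := by rw [Matrix.transpose_sub, Matrix.sub_mul, o1, o2, sub_zero]
  have c1' : D₂ᵀ * (C - D₁) = 0 := by simpa using congrArg Matrix.transpose c1
  have c2 : ip (C * D₂ᵀ) (C * D₂ᵀ) = ip (D₂ᵀ * D₂) (Cᵀ * C - D₁ᵀ * D₁) +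
      ip (D₁ * D₂ᵀ) (D₁ * D₂ᵀ) := by
    rw [ip_mul_mul_transpose, ip_mul_mul_transpose, ip_sub_right, ip_comm (Cᵀ * C),
      ip_comm (D₁ᵀ * D₁)]
    ring
  have n1 := ip_self_nonneg (D₁ * D₂ᵀ)
  have n2 := ip_self_nonneg (C * Cᵀ - D₁ * D₁ᵀ)
  have n3 : ip (D₂ᵀ * D₂) (D₂ᵀ * D₂) = ip (D₂ * D₂ᵀ) (D₂ * D₂ᵀ) := (ip_mul_mul_transpose _ _ _ _).symm
  have z1 : ip (C * (C - D₁)ᵀ - C * D₂ᵀ) (C * (C - D₁)ᵀ - C * D₂ᵀ) =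
      ip (C * (C - D₁)ᵀ) (C * (C - D₁)ᵀ) + ip (C * D₂ᵀ) (C * D₂ᵀ) := by
    have q1 : ip (C * (C - D₁)ᵀ) (C * D₂ᵀ) = 0 := by rw [ip_mul_mul_transpose, c1, ip_zero_right]
    rw [ip_sub_left, ip_sub_right, ip_sub_right, ip_comm (C * D₂ᵀ) (C * (C - D₁)ᵀ), q1]; ring
  have z2 : ip (C * Cᵀ - D₁ * D₁ᵀ - D₁ * D₂ᵀ - D₂ * D₁ᵀ - D₂ * D₂ᵀ)
      (C * Cᵀ - D₁ * D₁ᵀ - D₁ * D₂ᵀ - D₂ * D₁ᵀ - D₂ * D₂ᵀ) =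
      ip (C * Cᵀ - D₁ * D₁ᵀ) (C * Cᵀ - D₁ * D₁ᵀ) + 2 * ip (D₁ * D₂ᵀ) (D₁ * D₂ᵀ) +
        ip (D₂ * D₂ᵀ) (D₂ * D₂ᵀ) := by
    generalize hE : C * Cᵀ - D₁ * D₁ᵀ = E
    have q1 : ip E (D₁ * D₂ᵀ) = 0 := by
      rw [← hE, ip_sub_left, ip_mul_mul_transpose, ip_mul_mul_transpose, o1, o2]; simp
    have q2 : ip E (D₂ * D₁ᵀ) = 0 := by
      rw [← hE, ip_sub_left, ip_mul_mul_transpose, ip_mul_mul_transpose, o1, o2]; simp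
    have q3 : ip E (D₂ * D₂ᵀ) = 0 := by
      rw [← hE, ip_sub_left, ip_mul_mul_transpose, ip_mul_mul_transpose, o1, o2]; simp
    have q4 : ip (D₁ * D₂ᵀ) (D₂ * D₁ᵀ) = 0 := by rw [ip_mul_mul_transpose, o2, ip_zero_left]
    have q5 : ip (D₁ * D₂ᵀ) (D₂ * D₂ᵀ) = 0 := by rw [ip_mul_mul_transpose, o2, ip_zero_left]
    have q6 : ip (D₂ * D₁ᵀ) (D₂ * D₂ᵀ) = 0 := by rw [ip_mul_mul_transpose, o2, ip_zero_right]
    simp only [ip_sub_left, ip_sub_right, ip_comm _ E, q1, q2, q3, q4, q5, q6, c0,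
      ip_comm (D₂ * D₁ᵀ) (D₁ * D₂ᵀ), ip_comm (D₂ * D₂ᵀ) (D₁ * D₂ᵀ), ip_comm (D₂ * D₂ᵀ) (D₂ * D₁ᵀ)]
    ring
  have z3 : ip (C * Cᵀ - D₁ * D₁ᵀ - D₂ * D₁ᵀ) (C * Cᵀ - D₁ * D₁ᵀ - D₂ * D₁ᵀ) =
      ip (C * Cᵀ - D₁ * D₁ᵀ) (C * Cᵀ - D₁ * D₁ᵀ) + ip (D₁ * D₂ᵀ) (D₁ * D₂ᵀ) := by
    generalize hE : C * Cᵀ - D₁ * D₁ᵀ = E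
    have q2 : ip E (D₂ * D₁ᵀ) = 0 := by
      rw [← hE, ip_sub_left, ip_mul_mul_transpose, ip_mul_mul_transpose, o1, o2]; simp
    simp only [ip_sub_left, ip_sub_right, ip_comm _ E, q2, c0]
    ring
  rw [z1, z2, z3, c2]
  rw [ip_sub_left, ip_sub_right, ip_sub_right, ip_smul_left, ip_smul_right, ip_smul_left,
    ip_smul_right, ip_smul_left, ip_smul_right, ip_smul_left, ip_smul_right,
    ip_comm (Cᵀ * C - D₁ᵀ * D₁) (D₂ᵀ * D₂), n3] at b3
  linarith

end Alignment

/-! ### Singular value and polar decompositions, Rayleigh quotient -/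

section Spectral

/-- Diagonalization of the Gram matrix of `A` in an orthonormal basis of right singular vectors. -/
theorem exists_orthogonal_gram_eq_diagonal {m : Type*} [Fintype m] [DecidableEq m] {k : ℕ}
    (A : Matrix m (Fin k) ℝ) :
    ∃ O : Matrix (Fin k) (Fin k) ℝ, Oᵀ * O = 1 ∧ O * Oᵀ = 1 ∧
      (A * O)ᵀ * (A * O) = Matrix.diagonal fun i : Fin k => singularValue A i ^ 2 := by
  have hn : Module.finrank ℝ (EuclideanSpace ℝ (Fin k)) = k := by simp
  set T := Matrix.toEuclideanLin A with hT
  set b := T.isSymmetric_adjoint_comp_self.eigenvectorBasis hn with hb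
  have hbT : ∀ i, T.adjoint (T (b i)) = singularValue A i ^ 2 • b i := by
    intro i
    have := T.isSymmetric_adjoint_comp_self.apply_eigenvectorBasis hn i
    rw [← T.sq_singularValues_fin hn i] at this
    exact this
  have horth : ∀ i j, inner ℝ (b i) (b j) = if i = j then (1 : ℝ) else 0 := by
    intro i j; simpa using orthonormal_iff_ite.1 b.orthonormal i j
  have h1 : (Matrix.of fun i j => b j i)ᵀ * (Matrix.of fun i j => b j i) =
      (1 : Matrix (Fin k) (Fin k) ℝ) := by
    ext i j
    have := horth i j
    rw [PiLp.inner_apply] at this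
    simp only [RCLike.inner_apply, conj_trivial] at this
    simp only [Matrix.mul_apply, Matrix.transpose_apply, Matrix.of_apply, Matrix.one_apply]
    rw [← this]
    exact Finset.sum_congr rfl fun x _ => mul_comm _ _
  refine ⟨Matrix.of fun i j => b j i, h1, mul_eq_one_comm.1 h1, ?_⟩
  ext i j
  have h2 : inner ℝ (T (b i)) (T (b j)) = if i = j then singularValue A i ^ 2 else 0 := by
    rw [← LinearMap.adjoint_inner_left, hbT, inner_smul_left, horth]
    simp
  have h3 : ∀ j x, (A * Matrix.of fun i j => b j i) x j = T (b j) x := by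
    intro j x
    rw [hT, Matrix.toLpLin_apply]
    simp [Matrix.mul_apply, Matrix.mulVec, dotProduct]
  rw [PiLp.inner_apply] at h2
  simp only [RCLike.inner_apply, conj_trivial] at h2
  rw [Matrix.mul_apply]
  simp only [Matrix.transpose_apply, h3, Matrix.diagonal_apply]
  rw [← h2]
  exact Finset.sum_congr rfl fun x _ => mul_comm _ _

theorem singularValue_nonneg {m n : Type*} [Fintype m] [Fintype n] [DecidableEq n]
    (A : Matrix m n ℝ) (i : ℕ) : 0 ≤ singularValue A i :=
  LinearMap.singularValues_nonneg _ _

theorem singularValue_pos_iff {m n : Type*} [Fintype m] [Fintype n] [DecidableEq m]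
    [DecidableEq n] (A : Matrix m n ℝ) (i : ℕ) : 0 < singularValue A i ↔ i < A.rank := by
  rw [singularValue, LinearMap.singularValues_pos_iff_lt_finrank_range,
    Matrix.toEuclideanLin_eq_toLin_orthonormal, ← Matrix.rank_eq_finrank_range_toLin]

theorem singularValue_eq_zero_of_rank_le {m n : Type*} [Fintype m] [Fintype n] [DecidableEq m]
    [DecidableEq n] (A : Matrix m n ℝ) {i : ℕ} (hi : A.rank ≤ i) : singularValue A i = 0 :=
  le_antisymm (not_lt.1 fun h => absurd ((singularValue_pos_iff A i).1 h) (not_lt.2 hi))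
    (singularValue_nonneg A i)

theorem rho_nonneg {m n : Type*} [Fintype m] [Fintype n] [DecidableEq n]
    (A : Matrix m n ℝ) : 0 ≤ rho A :=
  Real.sInf_nonneg fun _ hs => hs.1.le

theorem rho_le_singularValue {m n : Type*} [Fintype m] [Fintype n] [DecidableEq n]
    (A : Matrix m n ℝ) {i : ℕ} (hi : singularValue A i ≠ 0) : rho A ≤ singularValue A i :=
  csInf_le ⟨0, fun _ hs => hs.1.le⟩ ⟨lt_of_le_of_ne (singularValue_nonneg A i) hi.symm, i, rfl⟩

theorem ip_diagonal_le {ν κ : Type*} [Fintype ν] [Fintype κ] [DecidableEq κ] {d : κ → ℝ}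
    (A : Matrix ν κ ℝ) (c : ℝ) (h : ∀ i, c ≤ d i) :
    c * ip A A ≤ ip A (A * Matrix.diagonal d) := by
  simp only [ip_eq_sum, Matrix.mul_diagonal, Finset.mul_sum]
  refine Finset.sum_le_sum fun i _ => Finset.sum_le_sum fun j _ => ?_
  nlinarith [mul_self_nonneg (A i j), h j]

/-- Normalizing the columns of a matrix with orthogonal columns. -/
theorem transpose_mul_normalized {ι κ : Type*} [Fintype ι] [Fintype κ] [DecidableEq κ]
    {C : Matrix ι κ ℝ} {a : κ → ℝ} (hC : Cᵀ * C = Matrix.diagonal fun i => a i ^ 2) :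
    (C * Matrix.diagonal fun i => (a i)⁻¹)ᵀ * (C * Matrix.diagonal fun i => (a i)⁻¹) =
      Matrix.diagonal fun i => if a i = 0 then (0 : ℝ) else 1 := by
  rw [Matrix.transpose_mul, Matrix.diagonal_transpose, Matrix.mul_assoc, ← Matrix.mul_assoc Cᵀ, hC,
    Matrix.diagonal_mul_diagonal, Matrix.diagonal_mul_diagonal]
  congr 1
  ext i
  split_ifs with h
  · simp [h]
  · field_simp

/-- The convention `0⁻¹ = 0` loses nothing, since a column with `a i = 0` has norm zero. The price
is that the normalized Gram matrix is a projection and not the identity. -/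
theorem normalized_mul_diagonal {ι κ : Type*} [Fintype ι] [Fintype κ] [DecidableEq κ]
    {C : Matrix ι κ ℝ} {a : κ → ℝ} (hC : Cᵀ * C = Matrix.diagonal fun i => a i ^ 2) :
    (C * Matrix.diagonal fun i => (a i)⁻¹) * Matrix.diagonal a = C := by
  rw [Matrix.mul_assoc, Matrix.diagonal_mul_diagonal]
  ext x i
  rw [Matrix.mul_diagonal]
  by_cases h : a i = 0
  · have h1 : (Cᵀ * C) i i = 0 := by rw [hC]; simp [h]
    rw [Matrix.mul_apply] at h1
    have h2 := (Finset.sum_eq_zero_iff_of_nonneg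
      (fun y _ => mul_self_nonneg (C y i))).1 h1 x (Finset.mem_univ _)
    have h3 : C x i = 0 := by simpa using h2
    simp [h3]
  · field_simp

theorem diagonal_ite_idem {κ : Type*} [Fintype κ] [DecidableEq κ] (a : κ → ℝ) :
    (Matrix.diagonal fun i => if a i = 0 then (0 : ℝ) else 1) *
      (Matrix.diagonal fun i => if a i = 0 then (0 : ℝ) else 1) =
      Matrix.diagonal fun i => if a i = 0 then (0 : ℝ) else 1 := by
  rw [Matrix.diagonal_mul_diagonal]
  congr 1
  ext i
  split_ifs <;> simp

/-- Every square real matrix becomes positive semidefinite after an orthogonal rotation. -/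
theorem exists_orthogonal_mul_eq_gram {k : ℕ} (M : Matrix (Fin k) (Fin k) ℝ) :
    ∃ R T : Matrix (Fin k) (Fin k) ℝ, Rᵀ * R = 1 ∧ R * Rᵀ = 1 ∧ M * R = Tᵀ * T := by
  obtain ⟨O, hO, hO', hG⟩ := exists_orthogonal_gram_eq_diagonal Mᵀ
  set s : Fin k → ℝ := fun i => singularValue Mᵀ i with hs
  have hs0 : ∀ i, 0 ≤ s i := fun i => singularValue_nonneg _ _
  set N := Mᵀ * O * Matrix.diagonal fun i => (s i)⁻¹ with hN
  have hN1 := transpose_mul_normalized (a := s) hG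
  have hN2 := normalized_mul_diagonal (a := s) hG
  rw [← hN] at hN1 hN2
  -- The nonzero normalized columns extend to an orthonormal basis `Q`. This gives `M = O diag(s)
  -- Qᵀ`, so `R = QOᵀ` yields `MR = O diag(s) Oᵀ`.
  have hv : Orthonormal ℝ (({i | s i ≠ 0} : Set (Fin k)).domRestrict
      fun i => (WithLp.toLp 2 (fun x => N x i) : EuclideanSpace ℝ (Fin k))) := by
    rw [orthonormal_iff_ite]
    rintro ⟨i, hi⟩ ⟨j, hj⟩
    have := congrFun (congrFun hN1 i) j
    simp only [Matrix.mul_apply, Matrix.transpose_apply, Matrix.diagonal_apply] at this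
    simp only [Set.domRestrict_apply, PiLp.inner_apply, RCLike.inner_apply, conj_trivial,
      Subtype.mk.injEq]
    rw [Set.mem_ofPred_eq] at hi
    rw [if_neg hi] at this
    rw [← this]
    exact Finset.sum_congr rfl fun x _ => mul_comm _ _
  obtain ⟨b, hb⟩ := hv.exists_orthonormalBasis_extension_of_card_eq (by simp)
  set Q : Matrix (Fin k) (Fin k) ℝ := Matrix.of fun x i => b i x with hQ
  have hQ1 : Qᵀ * Q = 1 := by
    ext i j
    have := orthonormal_iff_ite.1 b.orthonormal i j
    rw [PiLp.inner_apply] at this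
    simp only [RCLike.inner_apply, conj_trivial] at this
    simp only [Matrix.mul_apply, Matrix.transpose_apply, hQ, Matrix.of_apply, Matrix.one_apply]
    rw [← this]
    exact Finset.sum_congr rfl fun x _ => mul_comm _ _
  have hQ2 : Q * Qᵀ = 1 := mul_eq_one_comm.1 hQ1
  have hQs : Mᵀ * O = Q * Matrix.diagonal s := by
    rw [← hN2]
    ext x i
    rw [Matrix.mul_diagonal, Matrix.mul_diagonal]
    by_cases h : s i = 0
    · simp [h]
    · have := hb i h
      simp [hQ, this]
  have hM : M = O * Matrix.diagonal s * Qᵀ := by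
    have h1 : Mᵀ = Q * Matrix.diagonal s * Oᵀ := by
      rw [← hQs, Matrix.mul_assoc, hO', Matrix.mul_one]
    have := congrArg Matrix.transpose h1
    simpa [Matrix.transpose_mul, Matrix.mul_assoc] using this
  refine ⟨Q * Oᵀ, Matrix.diagonal (fun i => √(s i)) * Oᵀ, ?_, ?_, ?_⟩
  · rw [Matrix.transpose_mul, Matrix.transpose_transpose, Matrix.mul_assoc, ← Matrix.mul_assoc Qᵀ,
      hQ1, Matrix.one_mul, hO']
  · rw [Matrix.transpose_mul, Matrix.transpose_transpose, Matrix.mul_assoc, ← Matrix.mul_assoc Oᵀ,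
      hO, Matrix.one_mul, hQ2]
  · rw [hM, Matrix.transpose_mul, Matrix.transpose_transpose, Matrix.diagonal_transpose,
      Matrix.mul_assoc, ← Matrix.mul_assoc Qᵀ, hQ1, Matrix.one_mul, Matrix.mul_assoc,
      Matrix.mul_assoc, ← Matrix.mul_assoc (Matrix.diagonal _), Matrix.diagonal_mul_diagonal]
    congr 3
    ext i
    exact (Real.mul_self_sqrt (hs0 i)).symm

/-- A rotation-aligned difference of factors is controlled by the difference of Gram matrices, with
the smallest nonzero squared singular value of the factors as constant. -/
theorem mul_ip_sub_le_gram_sub {ι κ ν : Type*} [Fintype ι] [Fintype κ] [Fintype ν]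
    [DecidableEq κ] {C D C₀ D₀ : Matrix ι κ ℝ} {O₁ O₂ : Matrix κ κ ℝ} {T : Matrix ν κ ℝ}
    {a b : κ → ℝ} {ρ : ℝ} (hT : Cᵀ * D = Tᵀ * T) (hO₁ : O₁ᵀ * O₁ = 1) (hO₁' : O₁ * O₁ᵀ = 1)
    (hO₂ : O₂ᵀ * O₂ = 1) (hO₂' : O₂ * O₂ᵀ = 1)
    (hC : C = C₀ * O₁ᵀ) (hD : D = D₀ * O₂ᵀ)
    (hC₀ : C₀ᵀ * C₀ = Matrix.diagonal fun i => a i ^ 2)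
    (hD₀ : D₀ᵀ * D₀ = Matrix.diagonal fun i => b i ^ 2)
    (ha : ∀ i, 0 ≤ a i) (hb : ∀ i, 0 ≤ b i)
    (hρ : 0 ≤ ρ) (hρa : ∀ i, a i ≠ 0 → ρ ≤ a i ^ 2) (hρb : ∀ i, b i ≠ 0 → ρ ≤ b i ^ 2) :
    ρ * ip (C - D) (C - D) ≤ ip (C * Cᵀ - D * Dᵀ) (C * Cᵀ - D * Dᵀ) := by
  obtain ⟨P, hP⟩ : ∃ P, P = C₀ * Matrix.diagonal fun i => (a i)⁻¹ := ⟨_, rfl⟩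
  obtain ⟨Q, hQ⟩ : ∃ Q, Q = D₀ * Matrix.diagonal fun i => (b i)⁻¹ := ⟨_, rfl⟩
  have hPP := transpose_mul_normalized hC₀
  have hQQ := transpose_mul_normalized hD₀
  have hPa := normalized_mul_diagonal hC₀
  have hQb := normalized_mul_diagonal hD₀
  rw [← hP] at hPP hPa
  rw [← hQ] at hQQ hQb
  obtain ⟨t, ht⟩ : ∃ t, t = Pᵀ * Q := ⟨_, rfl⟩
  have hN : C₀ᵀ * D₀ = Matrix.diagonal a * t * Matrix.diagonal b := by
    rw [← hPa, ← hQb, ht, Matrix.transpose_mul, Matrix.diagonal_transpose]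
    simp only [Matrix.mul_assoc]
  have hCD : Cᵀ * D = O₁ * (C₀ᵀ * D₀) * O₂ᵀ := by
    rw [hC, hD, Matrix.transpose_mul, Matrix.transpose_transpose]
    simp only [Matrix.mul_assoc]
  have hdt : ∀ c : κ → ℝ, (Matrix.diagonal c)ᵀ = Matrix.diagonal c := Matrix.diagonal_transpose
  -- By Bessel the squares of the entries of `t` form a doubly substochastic matrix, which serves as
  -- weights in a termwise comparison.
  have hrow : ∀ i, ∑ j, t i j ^ 2 ≤ 1 := by
    intro i
    have h := ip_transpose_mul_self_le hQQ (hdt _) (diagonal_ite_idem b)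
      (Matrix.of fun (x : ι) (_ : Unit) => P x i)
    have h1 : Qᵀ * (Matrix.of fun (x : ι) (_ : Unit) => P x i) =
        Matrix.of fun j (_ : Unit) => t i j := by
      ext j u
      simp [ht, Matrix.mul_apply, mul_comm]
    have h2 := congrFun (congrFun hPP i) i
    rw [h1] at h
    simp only [ip_eq_sum, Matrix.of_apply, Finset.univ_unique, Finset.sum_singleton] at h
    simp only [Matrix.mul_apply, Matrix.transpose_apply, Matrix.diagonal_apply_eq] at h2
    rw [h2] at h
    calc ∑ j, t i j ^ 2 = ∑ j, t i j * t i j := by simp only [pow_two]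
      _ ≤ _ := h
      _ ≤ 1 := by split_ifs <;> norm_num
  have hcol : ∀ j, ∑ i, t i j ^ 2 ≤ 1 := by
    intro j
    have h := ip_transpose_mul_self_le hPP (hdt _) (diagonal_ite_idem a)
      (Matrix.of fun (x : ι) (_ : Unit) => Q x j)
    have h1 : Pᵀ * (Matrix.of fun (x : ι) (_ : Unit) => Q x j) =
        Matrix.of fun i (_ : Unit) => t i j := by
      ext j u
      simp [ht, Matrix.mul_apply]
    have h2 := congrFun (congrFun hQQ j) j
    rw [h1] at h
    simp only [ip_eq_sum, Matrix.of_apply, Finset.univ_unique, Finset.sum_singleton] at h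
    simp only [Matrix.mul_apply, Matrix.transpose_apply, Matrix.diagonal_apply_eq] at h2
    rw [h2] at h
    calc ∑ i, t i j ^ 2 = ∑ i, t i j * t i j := by simp only [pow_two]
      _ ≤ _ := h
      _ ≤ 1 := by split_ifs <;> norm_num
  -- Duality of trace and operator norm: `⟨C, D⟩` is the trace of the positive semidefinite `TᵀT`,
  -- and the other side pairs a rotation of it with the contraction `t`.
  have htr : ∑ i, ∑ j, a i * b j * t i j ^ 2 ≤ ip C D := by
    have h1 : ∑ i, ∑ j, a i * b j * t i j ^ 2 = ip (C₀ᵀ * D₀) t := by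
      rw [hN, ip_eq_sum]
      refine Finset.sum_congr rfl fun i _ => Finset.sum_congr rfl fun j _ => ?_
      rw [Matrix.mul_diagonal, Matrix.diagonal_mul]; ring
    have h2 : C₀ᵀ * D₀ = O₁ᵀ * (Tᵀ * T) * O₂ := by
      rw [← hT, hCD]
      calc C₀ᵀ * D₀ = (O₁ᵀ * O₁) * (C₀ᵀ * D₀) * (O₂ᵀ * O₂) := by
            rw [hO₁, hO₂, Matrix.one_mul, Matrix.mul_one]
        _ = _ := by simp only [Matrix.mul_assoc]
    have h3 : ip (C₀ᵀ * D₀) t = ip (T * O₂ * tᵀ) (T * O₁) := by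
      have h : O₁ᵀ * (Tᵀ * T) * O₂ = (T * O₁)ᵀ * (T * O₂) := by
        rw [Matrix.transpose_mul]; simp only [Matrix.mul_assoc]
      rw [h2, h, ip_mul_left, Matrix.transpose_transpose, ip_mul_right (T * O₂),
        Matrix.transpose_transpose]
    have h4 : ip (T * O₂ * tᵀ) (T * O₂ * tᵀ) ≤ ip T T := by
      have h : T * O₂ * tᵀ = (Pᵀ * (Q * (T * O₂)ᵀ))ᵀ := by
        rw [ht]; simp only [Matrix.transpose_mul, Matrix.transpose_transpose, Matrix.mul_assoc]
      calc ip (T * O₂ * tᵀ) (T * O₂ * tᵀ)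
          = ip (Pᵀ * (Q * (T * O₂)ᵀ)) (Pᵀ * (Q * (T * O₂)ᵀ)) := by rw [h, ip_transpose]
        _ ≤ ip (Q * (T * O₂)ᵀ) (Q * (T * O₂)ᵀ) :=
            ip_transpose_mul_self_le hPP (hdt _) (diagonal_ite_idem a) _
        _ ≤ ip (T * O₂)ᵀ (T * O₂)ᵀ := ip_mul_self_le hQQ (hdt _) (diagonal_ite_idem b) _
        _ = ip T T := by
            rw [ip_transpose, ip_mul_right, Matrix.mul_assoc, hO₂', Matrix.mul_one]
    have h5 : ip (T * O₁) (T * O₁) = ip T T := by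
      rw [ip_mul_right, Matrix.mul_assoc, hO₁', Matrix.mul_one]
    have h6 : ip C D = ip T T := by
      rw [ip, hT, ip]
    have h7 := two_mul_ip_le (T * O₂ * tᵀ) (T * O₁)
    linarith
  have hCC : ip C C = ∑ i, a i ^ 2 := by
    rw [hC, ip_mul_right, Matrix.transpose_transpose, Matrix.mul_assoc, hO₁, Matrix.mul_one, ip,
      hC₀, Matrix.trace_diagonal]
  have hDD : ip D D = ∑ i, b i ^ 2 := by
    rw [hD, ip_mul_right, Matrix.transpose_transpose, Matrix.mul_assoc, hO₂, Matrix.mul_one, ip,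
      hD₀, Matrix.trace_diagonal]
  have hgram : ip (C * Cᵀ - D * Dᵀ) (C * Cᵀ - D * Dᵀ) =
      ∑ i, a i ^ 4 + ∑ i, b i ^ 4 - 2 * ∑ i, ∑ j, a i ^ 2 * b j ^ 2 * t i j ^ 2 := by
    have e1 : C * Cᵀ = C₀ * C₀ᵀ := by
      rw [hC, Matrix.transpose_mul, Matrix.transpose_transpose, Matrix.mul_assoc,
        ← Matrix.mul_assoc O₁ᵀ, hO₁, Matrix.one_mul]
    have e2 : D * Dᵀ = D₀ * D₀ᵀ := by
      rw [hD, Matrix.transpose_mul, Matrix.transpose_transpose, Matrix.mul_assoc,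
        ← Matrix.mul_assoc O₂ᵀ, hO₂, Matrix.one_mul]
    have e3 : ∀ c : κ → ℝ, ip (Matrix.diagonal c) (Matrix.diagonal c) = ∑ i, c i ^ 2 := by
      intro c
      simp [ip, Matrix.trace_diagonal, pow_two]
    rw [e1, e2, ip_gram_sub, hC₀, hD₀, e3, e3, hN, ip_eq_sum]
    simp only [← pow_mul, Matrix.mul_diagonal, Matrix.diagonal_mul]
    congr 2
    refine Finset.sum_congr rfl fun i _ => Finset.sum_congr rfl fun j _ => ?_
    ring
  -- Where `t i j ≠ 0` both `a i` and `b j` are nonzero, and `(a i + b j)² ≥ ρ`.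
  have hterm : ∀ i j, 0 ≤ t i j ^ 2 * ((a i ^ 2 - b j ^ 2) ^ 2 - ρ * (a i - b j) ^ 2) := by
    intro i j
    by_cases hij : a i = 0 ∨ b j = 0
    · have : t i j = 0 := by
        rw [ht, hP, hQ, Matrix.transpose_mul, Matrix.mul_apply]
        simp only [Matrix.diagonal_transpose, Matrix.diagonal_mul, Matrix.mul_diagonal]
        rcases hij with h | h <;> simp [h]
      simp [this]
    · push Not at hij
      have h1 := hρa i hij.1
      have : (a i ^ 2 - b j ^ 2) ^ 2 - ρ * (a i - b j) ^ 2 =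
        (a i - b j) ^ 2 * ((a i + b j) ^ 2 - ρ) := by ring
      rw [this]
      have h2 : 0 ≤ (a i + b j) ^ 2 - ρ := by nlinarith [mul_nonneg (ha i) (hb j)]
      positivity
  have hdiag : ∀ (c : κ → ℝ), (∀ i, c i ≠ 0 → ρ ≤ c i ^ 2) → ∀ i, 0 ≤ c i ^ 4 - ρ * c i ^ 2 := by
    intro c hc i
    by_cases h : c i = 0
    · simp [h]
    · nlinarith [hc i h, sq_nonneg (c i)]
  have hsum := Finset.sum_nonneg fun i (_ : i ∈ Finset.univ) =>
    Finset.sum_nonneg fun j (_ : j ∈ Finset.univ) => hterm i j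
  have hsa := Finset.sum_nonneg fun i (_ : i ∈ Finset.univ) =>
    mul_nonneg (hdiag a hρa i) (sub_nonneg.2 (hrow i))
  have hsb := Finset.sum_nonneg fun j (_ : j ∈ Finset.univ) =>
    mul_nonneg (hdiag b hρb j) (sub_nonneg.2 (hcol j))
  -- The mass `1 - ∑ t²` missing from each row and column is paired with `a⁴ - ρa²` or `b⁴ - ρb²`,
  -- both nonnegative.
  have key : ∑ i, ∑ j, t i j ^ 2 * ((a i ^ 2 - b j ^ 2) ^ 2 - ρ * (a i - b j) ^ 2) +
      ∑ i, (a i ^ 4 - ρ * a i ^ 2) * (1 - ∑ j, t i j ^ 2) +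
      ∑ j, (b j ^ 4 - ρ * b j ^ 2) * (1 - ∑ i, t i j ^ 2) =
      (∑ i, a i ^ 4 + ∑ i, b i ^ 4 - 2 * ∑ i, ∑ j, a i ^ 2 * b j ^ 2 * t i j ^ 2) -
      ρ * (∑ i, a i ^ 2 + ∑ i, b i ^ 2 - 2 * ∑ i, ∑ j, a i * b j * t i j ^ 2) := by
    have hb' : ∑ j, (b j ^ 4 - ρ * b j ^ 2) * (1 - ∑ i, t i j ^ 2) =
        ∑ j, (b j ^ 4 - ρ * b j ^ 2) - ∑ i, ∑ j, (b j ^ 4 - ρ * b j ^ 2) * t i j ^ 2 := by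
      rw [Finset.sum_comm, ← Finset.sum_sub_distrib]
      refine Finset.sum_congr rfl fun j _ => ?_
      rw [← Finset.mul_sum]; ring
    have ha' : ∑ i, (a i ^ 4 - ρ * a i ^ 2) * (1 - ∑ j, t i j ^ 2) =
        ∑ i, (a i ^ 4 - ρ * a i ^ 2) - ∑ i, ∑ j, (a i ^ 4 - ρ * a i ^ 2) * t i j ^ 2 := by
      rw [← Finset.sum_sub_distrib]
      refine Finset.sum_congr rfl fun j _ => ?_
      rw [← Finset.mul_sum]; ring
    have hm : ∑ i, ∑ j, t i j ^ 2 * ((a i ^ 2 - b j ^ 2) ^ 2 - ρ * (a i - b j) ^ 2) =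
        ∑ i, ∑ j, (a i ^ 4 - ρ * a i ^ 2) * t i j ^ 2 +
        ∑ i, ∑ j, (b j ^ 4 - ρ * b j ^ 2) * t i j ^ 2 -
        2 * ∑ i, ∑ j, a i ^ 2 * b j ^ 2 * t i j ^ 2 +
        2 * ρ * ∑ i, ∑ j, a i * b j * t i j ^ 2 := by
      simp only [Finset.mul_sum, ← Finset.sum_add_distrib, ← Finset.sum_sub_distrib]
      refine Finset.sum_congr rfl fun i _ => Finset.sum_congr rfl fun j _ => ?_
      ring
    rw [ha', hb', hm, Finset.sum_sub_distrib, Finset.sum_sub_distrib, ← Finset.mul_sum,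
      ← Finset.mul_sum]
    ring
  have hsub : ip (C - D) (C - D) = ip C C + ip D D - 2 * ip C D := by
    rw [ip_sub_left, ip_sub_right, ip_sub_right, ip_comm D C]; ring
  rw [hsub, hCC, hDD, hgram]
  have := mul_le_mul_of_nonneg_left htr hρ
  linarith

/-- The smallest eigenvalue is a lower bound of the Rayleigh quotient. -/
theorem lambdaMin_mul_le {n : Type*} [Fintype n] [DecidableEq n] {H : Matrix n n ℝ}
    (hH : H.IsHermitian) (x : n → ℝ) : lambdaMin H * (x ⬝ᵥ x) ≤ x ⬝ᵥ H *ᵥ x := by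
  have hmem : ∀ i, lambdaMin H ≤ hH.eigenvalues i := by
    intro i
    have hset : {μ : ℝ | Module.End.HasEigenvalue (Matrix.toLin' H) μ} =
        Set.range hH.eigenvalues := by
      rw [← hH.spectrum_real_eq_range_eigenvalues, ← Matrix.spectrum_toLin']
      ext μ
      exact Module.End.hasEigenvalue_iff_mem_spectrum
    rw [lambdaMin, hset]
    exact csInf_le (Set.finite_range _).bddBelow ⟨i, rfl⟩
  obtain ⟨O, hO⟩ : ∃ O : Matrix n n ℝ, O = hH.eigenvectorUnitary := ⟨_, rfl⟩
  have hspec : H = O * Matrix.diagonal hH.eigenvalues * Oᵀ := by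
    have := hH.spectral_theorem
    rw [Unitary.conjStarAlgAut_apply] at this
    rw [hO]
    exact this
  have hOO : O * Oᵀ = 1 := by
    rw [hO]; exact Unitary.mul_star_self_of_mem hH.eigenvectorUnitary.2
  have h1 : x ⬝ᵥ H *ᵥ x = ∑ i, hH.eigenvalues i * (Oᵀ *ᵥ x) i ^ 2 := by
    conv_lhs => rw [hspec]
    rw [← Matrix.mulVec_mulVec, ← Matrix.mulVec_mulVec, Matrix.dotProduct_mulVec,
      ← Matrix.mulVec_transpose, dotProduct]
    refine Finset.sum_congr rfl fun i _ => ?_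
    rw [Matrix.mulVec_diagonal]; ring
  have h2 : x ⬝ᵥ x = ∑ i, (Oᵀ *ᵥ x) i ^ 2 := by
    have h : x ⬝ᵥ x = x ⬝ᵥ (O * Oᵀ) *ᵥ x := by rw [hOO, Matrix.one_mulVec]
    rw [h, ← Matrix.mulVec_mulVec, Matrix.dotProduct_mulVec, ← Matrix.mulVec_transpose, dotProduct]
    exact Finset.sum_congr rfl fun i _ => (pow_two _).symm
  rw [h1, h2, Finset.mul_sum]
  exact Finset.sum_le_sum fun i _ => mul_le_mul_of_nonneg_right (hmem i) (sq_nonneg _)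

end Spectral

/-! ### Nuclear norm through factorizations -/

section Nuclear

/-- With the partial isometry `B` from the polar decomposition of `UVᵀ`, the nuclear norm is `⟨UᵀB,
VᵀO⟩`; neither factor gains norm from `B` or `O`. -/
theorem nuclearNorm_mul_transpose_le {m ν : Type*} [Fintype m] [DecidableEq m] [Fintype ν] {k : ℕ}
    (U : Matrix m ν ℝ) (V : Matrix (Fin k) ν ℝ) :
    nuclearNorm (U * Vᵀ) ≤ (ip U U + ip V V) / 2 := by
  obtain ⟨O, hO, hO', hG⟩ := exists_orthogonal_gram_eq_diagonal (U * Vᵀ)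
  obtain ⟨s, hs⟩ : ∃ s : Fin k → ℝ, s = fun i : Fin k => singularValue (U * Vᵀ) i := ⟨_, rfl⟩
  obtain ⟨B, hB⟩ : ∃ B, B = U * Vᵀ * O * Matrix.diagonal fun i => (s i)⁻¹ := ⟨_, rfl⟩
  have hG' : (U * Vᵀ * O)ᵀ * (U * Vᵀ * O) = Matrix.diagonal fun i => s i ^ 2 := by rw [hG, hs]
  have h1 := transpose_mul_normalized hG'
  have h2 := normalized_mul_diagonal hG'
  rw [← hB] at h1 h2
  have h3 : nuclearNorm (U * Vᵀ) = ip (Uᵀ * B) (Vᵀ * O) := by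
    rw [ip_mul_left, Matrix.transpose_transpose, ← Matrix.mul_assoc, ← h2, ip, ← Matrix.mul_assoc,
      h1, Matrix.diagonal_mul_diagonal, Matrix.trace_diagonal, nuclearNorm, Fintype.card_fin,
      Finset.sum_range, hs]
    refine Finset.sum_congr rfl fun i _ => ?_
    split_ifs with h
    · simp [h]
    · simp
  have h4 : ip (Uᵀ * B) (Uᵀ * B) ≤ ip U U := by
    have := ip_transpose_mul_self_le h1 (Matrix.diagonal_transpose _) (diagonal_ite_idem s) U
    have h : Uᵀ * B = (Bᵀ * U)ᵀ := by rw [Matrix.transpose_mul, Matrix.transpose_transpose]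
    rwa [h, ip_transpose]
  have h5 : ip (Vᵀ * O) (Vᵀ * O) = ip V V := by
    rw [ip_mul_right, Matrix.mul_assoc, hO', Matrix.mul_one, ip_transpose]
  have h6 := two_mul_ip_le (Uᵀ * B) (Vᵀ * O)
  rw [h3]
  linarith

theorem sum_fin_eq_sum_fin_of_eq_zero {k r : ℕ} {F : ℕ → ℝ} (hk : ∀ j, k ≤ j → F j = 0)
    (hr : ∀ j, r ≤ j → F j = 0) : ∑ j : Fin r, F j = ∑ j : Fin k, F j := by
  rw [← Finset.sum_range, ← Finset.sum_range]
  rcases le_total r k with h | h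
  · exact Finset.sum_subset (Finset.range_mono h) fun j _ hj => hr j (by simpa using hj)
  · exact (Finset.sum_subset (Finset.range_mono h) fun j _ hj => hk j (by simpa using hj)).symm

/-- A balanced factorization of `X`, with orthogonal columns, that realizes the nuclear norm. -/
theorem exists_balanced_factorization {m : Type*} [Fintype m] [DecidableEq m] {k r : ℕ}
    (X : Matrix m (Fin k) ℝ) (hr : X.rank ≤ r) :
    ∃ (U : Matrix m (Fin r) ℝ) (V : Matrix (Fin k) (Fin r) ℝ), U * Vᵀ = X ∧
      Uᵀ * U = Matrix.diagonal (fun i : Fin r => singularValue X i) ∧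
      Vᵀ * V = Matrix.diagonal (fun i : Fin r => singularValue X i) ∧
      nuclearNorm X = (ip U U + ip V V) / 2 := by
  obtain ⟨O, hO, hO', hG⟩ := exists_orthogonal_gram_eq_diagonal X
  obtain ⟨s, hs⟩ : ∃ s : ℕ → ℝ, s = fun i => singularValue X i := ⟨_, rfl⟩
  have hs0 : ∀ i, 0 ≤ s i := fun i => by rw [hs]; exact singularValue_nonneg X i
  have hsr : ∀ i, r ≤ i → s i = 0 := fun i hi => by
    rw [hs]; exact singularValue_eq_zero_of_rank_le X (hr.trans hi)
  have hsk : ∀ i, k ≤ i → s i = 0 := fun i hi => by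
    rw [hs]; exact singularValue_eq_zero_of_rank_le X (((Matrix.rank_le_card_width X).trans (by simp)).trans hi)
  -- Singular vectors are padded by zero because `r` may exceed `k`.
  obtain ⟨o, ho⟩ : ∃ o : ℕ → Fin k → ℝ, o = fun j x => if h : j < k then O x ⟨j, h⟩ else 0 :=
    ⟨_, rfl⟩
  have hoO : ∀ (j : Fin k) x, o j x = O x j := fun j x => by simp [ho]
  have horth : ∀ i j : ℕ, i < k → ∑ x, o i x * o j x = if i = j then 1 else 0 := by
    intro i j hi
    by_cases hj : j < k
    · have := congrFun (congrFun hO ⟨i, hi⟩) ⟨j, hj⟩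
      simpa [Matrix.mul_apply, Matrix.one_apply, ho, hi, hj] using this
    · have : i ≠ j := by omega
      simp [ho, hj, this]
  have hX0 : ∀ j : ℕ, s j = 0 → ∀ x, ∑ y, X x y * o j y = 0 := by
    intro j hj x
    by_cases hjk : j < k
    · have h1 := congrFun (congrFun hG ⟨j, hjk⟩) ⟨j, hjk⟩
      have h0 : singularValue X j = 0 := by rw [hs] at hj; exact hj
      rw [Matrix.mul_apply, Matrix.diagonal_apply_eq, h0, zero_pow two_ne_zero] at h1
      have h2 := (Finset.sum_eq_zero_iff_of_nonneg
        (fun y _ => mul_self_nonneg ((X * O) y ⟨j, hjk⟩))).1 h1 x (Finset.mem_univ _)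
      have h3 : (X * O) x ⟨j, hjk⟩ = 0 := by simpa using h2
      simpa [Matrix.mul_apply, ho, hjk] using h3
    · simp [ho, hjk]
  have hGV : ∀ i j : ℕ, i < k → j < k →
      ∑ x, (∑ y, X x y * o i y) * (∑ y, X x y * o j y) = if i = j then s i ^ 2 else 0 := by
    intro i j hi hj
    have := congrFun (congrFun hG ⟨i, hi⟩) ⟨j, hj⟩
    rw [Matrix.mul_apply] at this
    simpa only [Matrix.mul_apply, Matrix.transpose_apply, Matrix.diagonal_apply, ho, hi, hj, hs,
      dite_true, Fin.mk.injEq] using this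
  obtain ⟨V, hV⟩ : ∃ V : Matrix (Fin k) (Fin r) ℝ, V = Matrix.of fun x (j : Fin r) => √(s j) * o j x :=
    ⟨_, rfl⟩
  obtain ⟨U, hU⟩ : ∃ U : Matrix m (Fin r) ℝ, U = Matrix.of fun x (j : Fin r) =>
      (√(s j))⁻¹ * ∑ y, X x y * o j y := ⟨_, rfl⟩
  have hVV : Vᵀ * V = Matrix.diagonal (fun i : Fin r => s i) := by
    ext i j
    have h1 : (Vᵀ * V) i j = √(s i) * √(s j) * ∑ x, o i x * o j x := by
      rw [Matrix.mul_apply, Finset.mul_sum]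
      refine Finset.sum_congr rfl fun x _ => ?_
      simp only [hV, Matrix.transpose_apply, Matrix.of_apply]; ring
    rw [h1, Matrix.diagonal_apply]
    by_cases hi : (i : ℕ) < k
    · rw [horth _ _ hi]
      by_cases hij : i = j
      · subst hij; simp [Real.mul_self_sqrt (hs0 _)]
      · have : (i : ℕ) ≠ j := fun h => hij (Fin.ext h)
        simp [hij, this]
    · simp [hsk i (not_lt.1 hi)]
  have hUU : Uᵀ * U = Matrix.diagonal (fun i : Fin r => s i) := by
    ext i j
    have h1 : (Uᵀ * U) i j = (√(s i))⁻¹ * (√(s j))⁻¹ *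
        ∑ x, (∑ y, X x y * o i y) * (∑ y, X x y * o j y) := by
      rw [Matrix.mul_apply, Finset.mul_sum]
      refine Finset.sum_congr rfl fun x _ => ?_
      simp only [hU, Matrix.transpose_apply, Matrix.of_apply]; ring
    rw [h1, Matrix.diagonal_apply]
    by_cases hi : (i : ℕ) < k
    · by_cases hj : (j : ℕ) < k
      · rw [hGV _ _ hi hj]
        by_cases hij : i = j
        · subst hij
          rw [if_pos rfl, if_pos rfl, ← mul_inv, Real.mul_self_sqrt (hs0 _)]
          by_cases h0 : s i = 0
          · simp [h0]
          · field_simp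
        · have : (i : ℕ) ≠ j := fun h => hij (Fin.ext h)
          simp [hij, this]
      · have hij : i ≠ j := fun h => hj (h ▸ hi)
        simp [hsk j (not_lt.1 hj), hij]
    · simp [hsk i (not_lt.1 hi)]
  have hUV : U * Vᵀ = X := by
    ext x y
    have h1 : (U * Vᵀ) x y = ∑ j : Fin r, (∑ z, X x z * o j z) * o j y := by
      rw [Matrix.mul_apply]
      refine Finset.sum_congr rfl fun j _ => ?_
      simp only [hU, hV, Matrix.transpose_apply, Matrix.of_apply]
      by_cases h0 : s j = 0
      · rw [hX0 _ h0]; simp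
      · have : √(s j) ≠ 0 := by
          rw [Real.sqrt_ne_zero']; exact lt_of_le_of_ne (hs0 _) (Ne.symm h0)
        field_simp
    have h2 := sum_fin_eq_sum_fin_of_eq_zero (k := k) (r := r)
      (F := fun j => (∑ z, X x z * o j z) * o j y)
      (fun j hj => by simp [hX0 j (hsk j hj)]) (fun j hj => by simp [hX0 j (hsr j hj)])
    rw [h1, h2]
    have h3 : X = X * O * Oᵀ := by rw [Matrix.mul_assoc, hO', Matrix.mul_one]
    conv_rhs => rw [h3]
    simp only [Matrix.mul_apply, Matrix.transpose_apply, hoO]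
  refine ⟨U, V, hUV, by rw [hUU, hs], by rw [hVV, hs], ?_⟩
  rw [ip, ip, hUU, hVV, Matrix.trace_diagonal, nuclearNorm, Fintype.card_fin, Finset.sum_range,
    sum_fin_eq_sum_fin_of_eq_zero hsk hsr, hs]
  ring

end Nuclear

/-! ### Rank bounds -/

section Rank

variable {m n : Type*} [Fintype n]

theorem rank_add_le (A B : Matrix m n ℝ) : (A + B).rank ≤ A.rank + B.rank := by
  classical
  rw [Matrix.rank, Matrix.rank, Matrix.rank, Matrix.mulVecLin_add]
  exact (Submodule.finrank_mono (LinearMap.range_add_le _ _)).trans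
    (Submodule.finrank_add_le_finrank_add_finrank _ _)

/-- Covers the segment from `X⋆` to `UVᵀ`, their difference, and the cross terms `AVᵀ + UBᵀ`: all
are sums of two products through dimension `r`. -/
theorem rank_mul_add_mul_le {r : ℕ} (A B : Matrix m (Fin r) ℝ) (C D : Matrix (Fin r) n ℝ) :
    (A * C + B * D).rank ≤ 2 * r := by
  have h : ∀ (A : Matrix m (Fin r) ℝ) (C : Matrix (Fin r) n ℝ), (A * C).rank ≤ r := fun A C =>
    (Matrix.rank_mul_le_left A C).trans ((Matrix.rank_le_card_width A).trans (by simp))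
  have := rank_add_le (A * C) (B * D)
  have := h A C
  have := h B D
  omega

end Rank

/-! ### Balanced pairs of factors -/

section Balanced

variable {m n κ : Type*} [Fintype m] [Fintype n] [Fintype κ]

theorem ip_fromRows (A C : Matrix m κ ℝ) (B D : Matrix n κ ℝ) :
    ip (Matrix.fromRows A B) (Matrix.fromRows C D) = ip A C + ip B D := by
  simp [ip, Matrix.transpose_fromRows, Matrix.fromCols_mul_fromRows]

theorem transpose_fromRows_mul_fromRows {m n κ : Type*} [Fintype m] [Fintype n]
    (A C : Matrix m κ ℝ) (B D : Matrix n κ ℝ) :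
    (Matrix.fromRows A B)ᵀ * Matrix.fromRows C D = Aᵀ * C + Bᵀ * D := by
  rw [Matrix.transpose_fromRows, Matrix.fromCols_mul_fromRows]

/-- The gap between the two sides is exactly `2‖UᵀU' - VᵀV'‖²`. -/
theorem balanced_gram_sub_le {U U' : Matrix m κ ℝ} {V V' : Matrix n κ ℝ} (h : Uᵀ * U = Vᵀ * V)
    (h' : U'ᵀ * U' = V'ᵀ * V') {C D : Matrix (m ⊕ n) κ ℝ} (hC : C = Matrix.fromRows U V)
    (hD : D = Matrix.fromRows U' V') :
    ip (C * Cᵀ - D * Dᵀ) (C * Cᵀ - D * Dᵀ) ≤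
      4 * ip (U * Vᵀ - U' * V'ᵀ) (U * Vᵀ - U' * V'ᵀ) := by
  have e := ip_self_nonneg (Uᵀ * U' - Vᵀ * V')
  rw [ip_gram_sub, hC, hD]
  simp only [transpose_fromRows_mul_fromRows, ip_sub_left, ip_sub_right, ip_mul_mul_transpose,
    ip_add_left, ip_add_right, h, h', ip_comm (U'ᵀ * U), ip_comm (Vᵀ * V') (Uᵀ * U')] at *
  have e1 : ip (V'ᵀ * V) (U'ᵀ * U) = ip (Uᵀ * U') (Vᵀ * V') := by
    rw [← ip_transpose, ip_comm]
    simp [Matrix.transpose_mul]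
  rw [e1]
  linarith

/-- Balancedness turns the right side into `2‖F₁Vᵀ‖² + 2‖UF₂ᵀ‖²`. -/
theorem ip_cross_le {U F₁ : Matrix m κ ℝ} {V F₂ : Matrix n κ ℝ} (h : Uᵀ * U = Vᵀ * V)
    {C F : Matrix (m ⊕ n) κ ℝ} (hC : C = Matrix.fromRows U V) (hF : F = Matrix.fromRows F₁ F₂) :
    ip (F₁ * Vᵀ + U * F₂ᵀ) (F₁ * Vᵀ + U * F₂ᵀ) ≤ ip (F * Cᵀ) (F * Cᵀ) := by
  have e := two_mul_ip_le (F₁ * Vᵀ) (U * F₂ᵀ)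
  rw [ip_mul_mul_transpose F, hC, hF, transpose_fromRows_mul_fromRows,
    transpose_fromRows_mul_fromRows]
  simp only [ip_add_left, ip_add_right, ip_comm (U * F₂ᵀ) (F₁ * Vᵀ)]
  simp only [ip_mul_mul_transpose F₁ V F₁ V, ip_mul_mul_transpose U F₂ U F₂, h,
    ip_comm (Vᵀ * V) (F₂ᵀ * F₂)] at *
  linarith

/-- `N` is the pseudoinverse of `CᵀC`; it makes `CNCᵀ` the orthogonal projection onto the range of
`C`. -/
theorem exists_gram_pseudoinverse {ι : Type*} [Fintype ι] [DecidableEq ι] {k : ℕ}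
    (C : Matrix ι (Fin k) ℝ) :
    ∃ N : Matrix (Fin k) (Fin k) ℝ, Nᵀ = N ∧ C * (Cᵀ * C * N) = C ∧ C * (N * (Cᵀ * C)) = C := by
  obtain ⟨O, hO, hO', hG⟩ := exists_orthogonal_gram_eq_diagonal C
  obtain ⟨s, hs⟩ : ∃ s : Fin k → ℝ, s = fun i : Fin k => singularValue C i := ⟨_, rfl⟩
  have hG' : (C * O)ᵀ * (C * O) = Matrix.diagonal fun i => s i ^ 2 := by rw [hG, hs]
  have h2 := normalized_mul_diagonal hG'
  have hgram : Cᵀ * C = O * (Matrix.diagonal fun i => s i ^ 2) * Oᵀ := by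
    rw [← hG', Matrix.transpose_mul]
    calc Cᵀ * C = (O * Oᵀ) * (Cᵀ * C) * (O * Oᵀ) := by rw [hO', Matrix.one_mul, Matrix.mul_one]
      _ = _ := by simp only [Matrix.mul_assoc]
  have hc : ∀ c d : Fin k → ℝ, (∀ i, c i * d i = (s i)⁻¹ * s i) →
      C * (O * Matrix.diagonal c * Oᵀ * (O * Matrix.diagonal d * Oᵀ)) = C := by
    intro c d hcd
    have h : O * Matrix.diagonal c * Oᵀ * (O * Matrix.diagonal d * Oᵀ) =
        O * ((Matrix.diagonal fun i => (s i)⁻¹) * Matrix.diagonal s) * Oᵀ := by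
      calc _ = O * Matrix.diagonal c * (Oᵀ * O) * Matrix.diagonal d * Oᵀ := by
            simp only [Matrix.mul_assoc]
        _ = O * (Matrix.diagonal c * Matrix.diagonal d) * Oᵀ := by
            rw [hO, Matrix.mul_one]; simp only [Matrix.mul_assoc]
        _ = _ := by rw [Matrix.diagonal_mul_diagonal, Matrix.diagonal_mul_diagonal]; simp only [hcd]
    rw [h]
    calc _ = (C * O * (Matrix.diagonal fun i => (s i)⁻¹) * Matrix.diagonal s) * Oᵀ := by
          simp only [Matrix.mul_assoc]
      _ = C := by rw [h2, Matrix.mul_assoc, hO', Matrix.mul_one]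
  refine ⟨O * (Matrix.diagonal fun i => (s i)⁻¹ ^ 2) * Oᵀ, ?_, ?_, ?_⟩
  · simp only [Matrix.transpose_mul, Matrix.transpose_transpose, Matrix.diagonal_transpose,
      Matrix.mul_assoc]
  · rw [hgram]
    refine hc _ _ fun i => ?_
    by_cases h : s i = 0
    · simp [h]
    · field_simp
  · rw [hgram]
    refine hc _ _ fun i => ?_
    by_cases h : s i = 0
    · simp [h]
    · field_simp

/-- The matrix `E = DᵀCN` is such that `(C - D E) Cᵀ` is the difference of Gram matrices projected
onto the range of `C`. -/
theorem half_ip_projected_le {U U' : Matrix m κ ℝ} {V V' : Matrix n κ ℝ}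
    (h' : U'ᵀ * U' = V'ᵀ * V') {C D : Matrix (m ⊕ n) κ ℝ}
    (h : Uᵀ * U = Vᵀ * V) (hC : C = Matrix.fromRows U V)
    (hD : D = Matrix.fromRows U' V') {P : Matrix (m ⊕ n) (m ⊕ n) ℝ} {E : Matrix κ κ ℝ}
    (hP : Pᵀ = P) (hPP : P * P = P)
    (hE : (C * Cᵀ - D * Dᵀ) * P = (C - D * E) * Cᵀ) :
    ip ((C * Cᵀ - D * Dᵀ) * P) ((C * Cᵀ - D * Dᵀ) * P) ≤
      2 * ip (U * Vᵀ - U' * V'ᵀ) ((U - U' * E) * Vᵀ + U * (V - V' * E)ᵀ) := by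
  have e0 : ip ((C * Cᵀ - D * Dᵀ) * P) ((C * Cᵀ - D * Dᵀ) * P) =
      ip (C * Cᵀ - D * Dᵀ) ((C - D * E) * Cᵀ) := by
    rw [ip_mul_right, Matrix.mul_assoc, hP, hPP, hE]
  obtain ⟨F₁, hF₁⟩ : ∃ F₁, F₁ = U - U' * E := ⟨_, rfl⟩
  obtain ⟨F₂, hF₂⟩ : ∃ F₂, F₂ = V - V' * E := ⟨_, rfl⟩
  have hF : C - D * E = Matrix.fromRows F₁ F₂ := by
    rw [hF₁, hF₂, hC, hD, Matrix.fromRows_mul]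
    ext i j
    rcases i with i | i <;> simp
  have e1 : ip (C * Cᵀ) ((C - D * E) * Cᵀ) = 2 * ip (U * Vᵀ) (F₁ * Vᵀ + U * F₂ᵀ) := by
    rw [ip_mul_mul_transpose, hF, hC, transpose_fromRows_mul_fromRows,
      transpose_fromRows_mul_fromRows, ip_add_right (U * Vᵀ), ip_mul_mul_transpose,
      ip_mul_mul_transpose]
    simp only [ip_add_left, ip_add_right, h]
    rw [ip_comm (Vᵀ * V) (Vᵀ * F₂)]
    ring
  -- Balancedness of `U', V'` cancels `E` here, so the defect in `e2` is a square.
  have hK : U'ᵀ * F₁ - V'ᵀ * F₂ = U'ᵀ * U - V'ᵀ * V := by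
    rw [hF₁, hF₂, Matrix.mul_sub, Matrix.mul_sub, ← Matrix.mul_assoc, ← Matrix.mul_assoc, h']
    abel
  have e2 : ip (D * Dᵀ) ((C - D * E) * Cᵀ) - 2 * ip (U' * V'ᵀ) (F₁ * Vᵀ + U * F₂ᵀ) =
      ip (U'ᵀ * F₁ - V'ᵀ * F₂) (U'ᵀ * U - V'ᵀ * V) := by
    rw [ip_mul_mul_transpose, hF, hC, hD, transpose_fromRows_mul_fromRows,
      transpose_fromRows_mul_fromRows, ip_add_right (U' * V'ᵀ), ip_mul_mul_transpose,
      ip_mul_mul_transpose]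
    simp only [ip_add_left, ip_add_right, ip_sub_left, ip_sub_right]
    rw [ip_comm (U'ᵀ * U) (V'ᵀ * F₂)]
    ring
  have e3 := ip_self_nonneg (U'ᵀ * U - V'ᵀ * V)
  rw [hK] at e2
  rw [e0, ← hF₁, ← hF₂, ip_sub_left, ip_sub_left, e1]
  linarith

end Balanced

/-! ### Derivatives along lines and parabolas -/

section Curves

variable {E : Type*} [NormedAddCommGroup E] [NormedSpace ℝ E] {f : E → ℝ}

theorem hasDerivAt_line (x v : E) (t : ℝ) : HasDerivAt (fun s : ℝ => x + s • v) v t := by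
  have h := ((hasDerivAt_id t).smul_const v).const_add x
  rwa [one_smul] at h

/-- A line in the factors moves the product `UVᵀ` along a parabola. -/
theorem hasDerivAt_parabola (x v w : E) :
    HasDerivAt (fun s : ℝ => x + s • v + s ^ 2 • w) v 0 := by
  have h := (hasDerivAt_line x v 0).add (((hasDerivAt_id (0 : ℝ)).pow 2).smul_const w)
  simp only [id_eq] at h
  convert! h using 1
  simp

theorem hasFDerivAt_fderiv (hf : ContDiff ℝ 2 f) (x : E) :
    HasFDerivAt (fderiv ℝ f) (fderiv ℝ (fderiv ℝ f) x) x :=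
  ((hf.fderiv_right (m := 1) (by norm_num)).differentiable (by norm_num) x).hasFDerivAt

theorem hasDerivAt_fderiv_line (hf : ContDiff ℝ 2 f) (x v w : E) (t : ℝ) :
    HasDerivAt (fun s : ℝ => fderiv ℝ f (x + s • v) w) (hessianForm f (x + t • v) v w) t := by
  have h := ((hasFDerivAt_fderiv hf _).comp_hasDerivAt t (hasDerivAt_line x v t)).clm_apply
    (hasDerivAt_const t w)
  simpa [hessianForm] using h

theorem hasDerivAt_comp_line (hf : ContDiff ℝ 2 f) (x v : E) :
    HasDerivAt (fun s : ℝ => f (x + s • v)) (fderiv ℝ f x v) 0 := by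
  have h := ((hf.differentiable (by norm_num)) (x + (0 : ℝ) • v)).hasFDerivAt.comp_hasDerivAt
    (0 : ℝ) (hasDerivAt_line x v 0)
  simpa [Function.comp_def] using h

theorem hasDerivAt_comp_parabola (hf : ContDiff ℝ 2 f) (x v w : E) :
    HasDerivAt (fun s : ℝ => f (x + s • v + s ^ 2 • w)) (fderiv ℝ f x v) 0 := by
  have h := ((hf.differentiable (by norm_num))
    (x + (0 : ℝ) • v + (0 : ℝ) ^ 2 • w)).hasFDerivAt.comp_hasDerivAt
    (0 : ℝ) (hasDerivAt_parabola x v w)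
  simpa [Function.comp_def] using h

theorem hasDerivAt_fderiv_parabola (hf : ContDiff ℝ 2 f) (x v w : E) :
    HasDerivAt (fun s : ℝ => fderiv ℝ f (x + s • v + s ^ 2 • w) (v + s • (2 : ℝ) • w))
      (hessianForm f x v v + 2 * fderiv ℝ f x w) 0 := by
  have h0 : x = x + (0 : ℝ) • v + (0 : ℝ) ^ 2 • w := by simp
  have h1 := (hasFDerivAt_fderiv hf x).comp_hasDerivAt_of_eq (0 : ℝ)
    (hasDerivAt_parabola x v w) h0
  have h2 := h1.clm_apply (hasDerivAt_line v ((2 : ℝ) • w) 0)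
  simp only [zero_smul, add_zero, Function.comp_apply] at h2
  rw [zero_pow two_ne_zero, zero_smul, add_zero, map_smul, smul_eq_mul] at h2
  exact h2

theorem hessianForm_comm {E : Type*} [NormedAddCommGroup E] [NormedSpace ℝ E] {f : E → ℝ}
    (hf : ContDiff ℝ 2 f) (X D D' : E) :
    hessianForm f X D D' = hessianForm f X D' D :=
  (hf.contDiffAt.isSymmSndFDerivAt (by simp)) D D'

end Curves

/-! ### Gradient and Hessian in matrix form -/

section Calculus

variable {m n : Type*} [Fintype m] [Fintype n] [DecidableEq m] [DecidableEq n]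

/-- The gradient of `f` with respect to the Frobenius inner product. -/
def grad (f : Matrix m n ℝ → ℝ) (X : Matrix m n ℝ) : Matrix m n ℝ :=
  Matrix.of fun i j => fderiv ℝ f X (Matrix.single i j 1)

theorem fderiv_eq_ip_grad (f : Matrix m n ℝ → ℝ) (X D : Matrix m n ℝ) :
    fderiv ℝ f X D = ip (grad f X) D := by
  conv_lhs => rw [Matrix.matrix_eq_sum_single D]
  rw [ip_eq_sum, map_sum]
  refine Finset.sum_congr rfl fun i _ => ?_
  rw [map_sum]
  refine Finset.sum_congr rfl fun j _ => ?_
  have : Matrix.single i j (D i j) = D i j • Matrix.single i j (1 : ℝ) := by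
    rw [Matrix.smul_single, smul_eq_mul, mul_one]
  rw [this, map_smul, smul_eq_mul, mul_comm]; rfl

theorem hessianMatrix_isHermitian {f : Matrix m n ℝ → ℝ} (hf : ContDiff ℝ 2 f)
    (X : Matrix m n ℝ) : (hessianMatrix f X).IsHermitian := by
  ext a b
  simp only [hessianMatrix, Matrix.conjTranspose_apply, Matrix.of_apply, star_trivial]
  exact hessianForm_comm hf _ _ _

theorem hessianForm_self_eq (f : Matrix m n ℝ → ℝ) (X D : Matrix m n ℝ) :
    hessianForm f X D D =
      (fun a : m × n => D a.1 a.2) ⬝ᵥ hessianMatrix f X *ᵥ (fun a : m × n => D a.1 a.2) := by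
  have hD : D = ∑ a : m × n, D a.1 a.2 • Matrix.single a.1 a.2 (1 : ℝ) := by
    conv_lhs => rw [Matrix.matrix_eq_sum_single D]
    rw [Fintype.sum_prod_type]
    refine Finset.sum_congr rfl fun i _ => Finset.sum_congr rfl fun j _ => ?_
    rw [Matrix.smul_single, smul_eq_mul, mul_one]
  unfold hessianForm
  conv_lhs => rw [hD]
  simp only [map_sum, map_smul, sum_apply, smul_apply,
    dotProduct, Matrix.mulVec, Finset.mul_sum, smul_eq_mul, hessianMatrix, Matrix.of_apply,
    hessianForm]
  rw [Finset.sum_comm]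
  refine Finset.sum_congr rfl fun a _ => Finset.sum_congr rfl fun b _ => ?_
  ring

theorem lambdaMin_hessianMatrix_mul_le {f : Matrix m n ℝ → ℝ} (hf : ContDiff ℝ 2 f)
    (X D : Matrix m n ℝ) : lambdaMin (hessianMatrix f X) * ip D D ≤ hessianForm f X D D := by
  rw [hessianForm_self_eq]
  refine le_trans (le_of_eq ?_) (lambdaMin_mul_le (hessianMatrix_isHermitian hf X) _)
  rw [ip_eq_sum, dotProduct, Fintype.sum_prod_type]

theorem le_ip_grad_sub {f : Matrix m n ℝ → ℝ} (hf : ContDiff ℝ 2 f)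
    (X L H : Matrix m n ℝ) (c : ℝ)
    (h : ∀ t : ℝ, c ≤ hessianForm f (X + t • L) L H) :
    c ≤ ip (grad f (X + L) - grad f X) H := by
  obtain ⟨t, -, ht⟩ := exists_hasDerivAt_eq_slope (fun s : ℝ => fderiv ℝ f (X + s • L) H)
    (fun t => hessianForm f (X + t • L) L H) zero_lt_one
    (fun t _ => (hasDerivAt_fderiv_line hf X L H t).continuousAt.continuousWithinAt)
    (fun t _ => hasDerivAt_fderiv_line hf X L H t)
  simp only [one_smul, zero_smul, add_zero, sub_zero, div_one, fderiv_eq_ip_grad] at ht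
  rw [ip_sub_left, ← ht]
  exact h t

end Calculus

/-! ### Derivatives of the factored objective and its critical points -/

section Factored

variable {p q r : ℕ} {f : Matrix (Fin p) (Fin q) ℝ → ℝ}

theorem factored_fromRows (lam : ℝ) (U : Matrix (Fin p) (Fin r) ℝ) (V : Matrix (Fin q) (Fin r) ℝ) :
    factored f lam (Matrix.fromRows U V) = f (U * Vᵀ) + lam * ((ip U U + ip V V) / 2) := by
  simp only [factored, Matrix.toRows₁_fromRows, Matrix.toRows₂_fromRows, norm_sq_eq_ip]

theorem contDiff_entry {m n : Type*} [Fintype m] [Fintype n] (i : m) (j : n) {k : WithTop ℕ∞} :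
    ContDiff ℝ k fun W : Matrix m n ℝ => W i j :=
  (LinearMap.toContinuousLinearMap (Matrix.entryLinearMap ℝ ℝ i j)).contDiff

theorem contDiff_factored (hf : ContDiff ℝ 2 f) (lam : ℝ) :
    ContDiff ℝ 2 (factored (r := r) f lam) := by
  -- Expanding in entries makes the smoothness that of polynomials composed with `f`.
  have h1 : ∀ W : Matrix (Fin p ⊕ Fin q) (Fin r) ℝ, W.toRows₁ * W.toRows₂ᵀ =
      ∑ i, ∑ j, (∑ k, W (Sum.inl i) k * W (Sum.inr j) k) • Matrix.single i j (1 : ℝ) := by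
    intro W
    conv_lhs => rw [Matrix.matrix_eq_sum_single (W.toRows₁ * W.toRows₂ᵀ)]
    refine Finset.sum_congr rfl fun i _ => Finset.sum_congr rfl fun j _ => ?_
    rw [Matrix.smul_single, smul_eq_mul, mul_one, Matrix.mul_apply]
    rfl
  have h2 : factored (r := r) f lam = fun W => f (∑ i, ∑ j,
      (∑ k, W (Sum.inl i) k * W (Sum.inr j) k) • Matrix.single i j (1 : ℝ)) +
      lam * ((∑ i, ∑ k, W (Sum.inl i) k * W (Sum.inl i) k +
        ∑ j, ∑ k, W (Sum.inr j) k * W (Sum.inr j) k) / 2) := by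
    ext W
    rw [← h1, factored, norm_sq_eq_ip, norm_sq_eq_ip, ip_eq_sum, ip_eq_sum]
    rfl
  rw [h2]
  refine ContDiff.add (hf.comp ?_) (contDiff_const.mul (ContDiff.div_const (ContDiff.add ?_ ?_) 2))
  · exact ContDiff.sum fun i _ => ContDiff.sum fun j _ => ContDiff.smul (ContDiff.sum fun k _ =>
      (contDiff_entry _ _).mul (contDiff_entry _ _)) contDiff_const
  · exact ContDiff.sum fun i _ => ContDiff.sum fun k _ =>
      (contDiff_entry _ _).mul (contDiff_entry _ _)
  · exact ContDiff.sum fun i _ => ContDiff.sum fun k _ =>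
      (contDiff_entry _ _).mul (contDiff_entry _ _)

theorem product_line (U A : Matrix (Fin p) (Fin r) ℝ) (V B : Matrix (Fin q) (Fin r) ℝ) (t : ℝ) :
    (U + t • A) * (V + t • B)ᵀ = U * Vᵀ + t • (A * Vᵀ + U * Bᵀ) + t ^ 2 • (A * Bᵀ) := by
  simp only [Matrix.transpose_add, Matrix.transpose_smul, Matrix.add_mul, Matrix.mul_add,
    Matrix.smul_mul, Matrix.mul_smul]
  module

theorem fromRows_line (U A : Matrix (Fin p) (Fin r) ℝ) (V B : Matrix (Fin q) (Fin r) ℝ) (t : ℝ) :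
    Matrix.fromRows U V + t • Matrix.fromRows A B = Matrix.fromRows (U + t • A) (V + t • B) := by
  ext i j
  rcases i with i | i <;> simp

theorem fderiv_factored (hf : ContDiff ℝ 2 f) (lam : ℝ)
    (U A : Matrix (Fin p) (Fin r) ℝ) (V B : Matrix (Fin q) (Fin r) ℝ) :
    fderiv ℝ (factored f lam) (Matrix.fromRows U V) (Matrix.fromRows A B) =
      fderiv ℝ f (U * Vᵀ) (A * Vᵀ + U * Bᵀ) + lam * (ip U A + ip V B) := by
  have h1 := hasDerivAt_comp_line (contDiff_factored (r := r) hf lam) (Matrix.fromRows U V)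
    (Matrix.fromRows A B)
  -- The regularizer is itself a scalar parabola in `t`; uniqueness of the derivative of the common
  -- function gives the formula.
  have h2 := (hasDerivAt_comp_parabola hf (U * Vᵀ) (A * Vᵀ + U * Bᵀ) (A * Bᵀ)).add
    (hasDerivAt_parabola (lam * ((ip U U + ip V V) / 2)) (lam * (ip U A + ip V B))
      (lam * ((ip A A + ip B B) / 2)))
  refine h1.unique (h2.congr_of_eventuallyEq (Filter.Eventually.of_forall fun t => ?_))
  simp only [Pi.add_apply, fromRows_line, factored_fromRows, product_line, ip_add_left,
    ip_add_right, ip_smul_left, ip_smul_right, ip_comm A U, ip_comm B V, smul_eq_mul]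
  ring

theorem hessianForm_factored (hf : ContDiff ℝ 2 f) (lam : ℝ)
    (U A : Matrix (Fin p) (Fin r) ℝ) (V B : Matrix (Fin q) (Fin r) ℝ) :
    hessianForm (factored f lam) (Matrix.fromRows U V) (Matrix.fromRows A B)
        (Matrix.fromRows A B) =
      hessianForm f (U * Vᵀ) (A * Vᵀ + U * Bᵀ) (A * Vᵀ + U * Bᵀ) +
        2 * ip (grad f (U * Vᵀ)) (A * Bᵀ) + lam * (ip A A + ip B B) := by
  have h1 := hasDerivAt_fderiv_line (contDiff_factored (r := r) hf lam) (Matrix.fromRows U V)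
    (Matrix.fromRows A B) (Matrix.fromRows A B) 0
  rw [zero_smul, add_zero] at h1
  have h2 := (hasDerivAt_fderiv_parabola hf (U * Vᵀ) (A * Vᵀ + U * Bᵀ) (A * Bᵀ)).add
    (hasDerivAt_line (lam * (ip U A + ip V B)) (lam * (ip A A + ip B B)) 0)
  rw [← fderiv_eq_ip_grad]
  refine h1.unique (h2.congr_of_eventuallyEq (Filter.Eventually.of_forall fun t => ?_))
  have h : A * (V + t • B)ᵀ + (U + t • A) * Bᵀ = A * Vᵀ + U * Bᵀ + t • (2 : ℝ) • (A * Bᵀ) := by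
    simp only [Matrix.transpose_add, Matrix.transpose_smul, Matrix.add_mul, Matrix.mul_add,
      Matrix.smul_mul, Matrix.mul_smul]
    module
  beta_reduce
  rw [fromRows_line]
  refine (fderiv_factored hf lam (U + t • A) A (V + t • B) B).trans ?_
  rw [h, product_line, ip_add_left, ip_add_left, ip_smul_left, ip_smul_left, Pi.add_apply,
    smul_eq_mul]
  refine congrArg₂ (fun a b : ℝ => a + b) rfl ?_
  ring

/-- At a critical point of the factored objective the factors are singular vectors of the
gradient. -/
theorem grad_mul_of_isCriticalPoint (hf : ContDiff ℝ 2 f) {lam : ℝ}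
    {U : Matrix (Fin p) (Fin r) ℝ} {V : Matrix (Fin q) (Fin r) ℝ}
    (h : fderiv ℝ (factored f lam) (Matrix.fromRows U V) = 0) :
    grad f (U * Vᵀ) * V = -(lam • U) ∧ (grad f (U * Vᵀ))ᵀ * U = -(lam • V) := by
  have hz : ∀ (A : Matrix (Fin p) (Fin r) ℝ) (B : Matrix (Fin q) (Fin r) ℝ),
      ip (grad f (U * Vᵀ) * V + lam • U) A + ip ((grad f (U * Vᵀ))ᵀ * U + lam • V) B = 0 := by
    intro A B
    have h1 := fderiv_factored hf lam U A V B
    rw [h, fderiv_eq_ip_grad, ip_add_right] at h1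
    have h2 : ip (grad f (U * Vᵀ)) (A * Vᵀ) = ip (grad f (U * Vᵀ) * V) A := by
      rw [ip_mul_right]
    have h3 : ip (grad f (U * Vᵀ)) (U * Bᵀ) = ip ((grad f (U * Vᵀ))ᵀ * U) B := by
      rw [ip_comm, ip_mul_left, ← ip_transpose, Matrix.transpose_transpose, Matrix.transpose_mul,
        Matrix.transpose_transpose, ip_comm]
    rw [h2, h3, zero_apply] at h1
    simp only [ip_add_left, ip_smul_left]
    linarith
  constructor
  · have := hz (grad f (U * Vᵀ) * V + lam • U) 0
    rw [ip_zero_right, add_zero, ip_self_eq_zero] at this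
    exact eq_neg_of_add_eq_zero_left this
  · have := hz 0 ((grad f (U * Vᵀ))ᵀ * U + lam • V)
    rw [ip_zero_right, zero_add, ip_self_eq_zero] at this
    exact eq_neg_of_add_eq_zero_left this

/-- Evaluate `UᵀGV` in two ways. -/
theorem balanced_of_isCriticalPoint {lam : ℝ} (hlam : lam ≠ 0) {G : Matrix (Fin p) (Fin q) ℝ}
    {U : Matrix (Fin p) (Fin r) ℝ} {V : Matrix (Fin q) (Fin r) ℝ}
    (h₁ : G * V = -(lam • U)) (h₂ : Gᵀ * U = -(lam • V)) : Uᵀ * U = Vᵀ * V := by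
  have e1 : Uᵀ * (G * V) = -(lam • (Uᵀ * U)) := by rw [h₁]; simp
  have e2 : (Gᵀ * U)ᵀ * V = -(lam • (Vᵀ * V)) := by rw [h₂]; simp
  rw [Matrix.transpose_mul, Matrix.transpose_transpose, Matrix.mul_assoc, e1] at e2
  exact smul_right_injective _ hlam (neg_injective e2)

end Factored

/-! ### First-order conditions at the minimizer -/

section Optimality

open Filter Topology in
theorem nonneg_of_hasDerivAt_of_le {φ : ℝ → ℝ} {d : ℝ} (h : HasDerivAt φ d 0)
    (hφ : ∀ s, 0 ≤ s → φ 0 ≤ φ s) : 0 ≤ d := by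
  refine ge_of_tendsto h.tendsto_slope_zero_right ?_
  filter_upwards [self_mem_nhdsWithin] with s hs
  have hs' : (0 : ℝ) < s := hs
  rw [zero_add, smul_eq_mul]
  exact mul_nonneg (inv_nonneg.2 hs'.le) (sub_nonneg.2 (hφ s hs'.le))

variable {p q r : ℕ} {f : Matrix (Fin p) (Fin q) ℝ → ℝ} {lam : ℝ} {X : Matrix (Fin p) (Fin q) ℝ}

/-- The factored objective dominates the nuclear norm objective, with equality at these factors, so
they minimize it globally. -/
theorem fderiv_factored_eq_zero_of_isMinimizer (hlam : 0 ≤ lam)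
    (hopt : ∀ Y, f X + lam * nuclearNorm X ≤ f Y + lam * nuclearNorm Y)
    {U : Matrix (Fin p) (Fin r) ℝ} {V : Matrix (Fin q) (Fin r) ℝ} (hX : U * Vᵀ = X)
    (hnuc : nuclearNorm X = (ip U U + ip V V) / 2) :
    fderiv ℝ (factored f lam) (Matrix.fromRows U V) = 0 := by
  refine IsLocalMin.fderiv_eq_zero (Filter.Eventually.of_forall fun W => ?_)
  rw [← Matrix.fromRows_toRows W, factored_fromRows, factored_fromRows, hX, ← hnuc]
  refine (hopt (W.toRows₁ * W.toRows₂ᵀ)).trans ?_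
  have := mul_le_mul_of_nonneg_left (nuclearNorm_mul_transpose_le W.toRows₁ W.toRows₂) hlam
  linarith

/-- A factored form of the bound `lam` on the operator norm of the gradient at `X`. -/
theorem ip_grad_nonneg_of_isMinimizer (hf : ContDiff ℝ 2 f) (hlam : 0 ≤ lam)
    (hopt : ∀ Y, f X + lam * nuclearNorm X ≤ f Y + lam * nuclearNorm Y)
    {U : Matrix (Fin p) (Fin r) ℝ} {V : Matrix (Fin q) (Fin r) ℝ} (hX : U * Vᵀ = X)
    (hnuc : nuclearNorm X = (ip U U + ip V V) / 2)
    (A : Matrix (Fin p) (Fin r) ℝ) (B : Matrix (Fin q) (Fin r) ℝ) :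
    0 ≤ 2 * ip (grad f X) (A * Bᵀ) + lam * (ip A A + ip B B) := by
  have h := (hasDerivAt_comp_line hf X (A * Bᵀ)).add
    (hasDerivAt_line (lam * nuclearNorm X) (lam * ((ip A A + ip B B) / 2)) 0)
  have h0 := nonneg_of_hasDerivAt_of_le h fun s hs => ?_
  · have e := fderiv_eq_ip_grad f X (A * Bᵀ)
    have e' : 0 ≤ ip (grad f X) (A * Bᵀ) + lam * ((ip A A + ip B B) / 2) := by
      rw [← e]; exact h0
    linarith
  -- Appending columns `√s A` and `√s B` to the factors bounds the nuclear norm by a function linear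
  -- in `s`, which can be differentiated at `0`.
  · have h1 : X + s • (A * Bᵀ) = Matrix.fromCols U (√s • A) * (Matrix.fromCols V (√s • B))ᵀ := by
      rw [Matrix.transpose_fromCols, Matrix.fromCols_mul_fromRows, hX, Matrix.transpose_smul,
        Matrix.smul_mul, Matrix.mul_smul, smul_smul, Real.mul_self_sqrt hs]
    have h2 : ∀ (k : ℕ) (M N : Matrix (Fin k) (Fin r) ℝ),
        ip (Matrix.fromCols M (√s • N)) (Matrix.fromCols M (√s • N)) = ip M M + s * ip N N := by
      intro k M N
      rw [← ip_transpose, Matrix.transpose_fromCols, ip_fromRows, ip_transpose, ip_transpose,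
        ip_smul_left, ip_smul_right, ← mul_assoc, Real.mul_self_sqrt hs]
    have h3 := nuclearNorm_mul_transpose_le (Matrix.fromCols U (√s • A))
      (Matrix.fromCols V (√s • B))
    rw [← h1, h2, h2] at h3
    have h4 := mul_le_mul_of_nonneg_left h3 hlam
    have h5 := hopt (X + s • (A * Bᵀ))
    simp only [Pi.add_apply, zero_smul, add_zero, smul_eq_mul, zero_mul]
    have h6 : lam * ((ip U U + s * ip A A + (ip V V + s * ip B B)) / 2) =
      lam * nuclearNorm X + s * (lam * ((ip A A + ip B B) / 2)) := by rw [hnuc]; ring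
    rw [h6] at h4
    exact h5.trans (add_le_add_right h4 _)

end Optimality

/-! ### Negative curvature towards the minimizer -/

section Descent

variable {p q r : ℕ} {f : Matrix (Fin p) (Fin q) ℝ → ℝ} {lam c : ℝ}

/-- Polarization: the lower bound at `L + 5/2 H` minus the upper bound at `L - 5/2 H`. The weight
`5/2` suits `‖H‖ ≈ 2/5 ‖L‖`, the extreme case in `hz_le`. These combinations are where rank `4r` is
needed. -/
theorem hessianForm_ge_of_restricted (hf : ContDiff ℝ 2 f)
    (hwc : ∀ X D : Matrix (Fin p) (Fin q) ℝ, X.rank ≤ 2 * r → D.rank ≤ 4 * r →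
      c * ip D D ≤ hessianForm f X D D ∧ hessianForm f X D D ≤ 3 / 2 * c * ip D D)
    {X L H : Matrix (Fin p) (Fin q) ℝ} (hX : X.rank ≤ 2 * r) (hL : L.rank ≤ 2 * r)
    (hH : H.rank ≤ 2 * r) :
    5 / 4 * c * ip L H - c / 8 * (2 / 5 * ip L L + 5 / 2 * ip H H) ≤ hessianForm f X L H := by
  have hrank : ∀ a : ℝ, (L + a • H).rank ≤ 4 * r := by
    intro a
    have h1 := rank_add_le L (a • H)
    have h2 : (a • H).rank ≤ H.rank := by
      have : a • H = H * (a • (1 : Matrix (Fin q) (Fin q) ℝ)) := by simp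
      rw [this]; exact Matrix.rank_mul_le_left _ _
    omega
  have hexp : ∀ a : ℝ, hessianForm f X (L + a • H) (L + a • H) =
      hessianForm f X L L + 2 * a * hessianForm f X L H + a ^ 2 * hessianForm f X H H := by
    intro a
    have hs := hessianForm_comm hf X H L
    unfold hessianForm at *
    simp only [map_add, map_smul, add_apply, smul_apply, smul_eq_mul]
    rw [hs]; ring
  have h1 := (hwc X _ hX (hrank (5 / 2))).1
  have h2 := (hwc X _ hX (hrank (-(5 / 2)))).2
  rw [hexp] at h1 h2
  simp only [ip_add_left, ip_add_right, ip_smul_left, ip_smul_right, ip_comm H L] at h1 h2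
  linarith

/-- The curvature of the factored objective at a critical point, in the direction of the aligned
difference to the factors of the minimizer. -/
theorem hessianForm_factored_sub_le (hf : ContDiff ℝ 2 f) (hlam : lam ≠ 0) (hc : 0 < c)
    (hwc : ∀ X D : Matrix (Fin p) (Fin q) ℝ, X.rank ≤ 2 * r → D.rank ≤ 4 * r →
      c * ip D D ≤ hessianForm f X D D ∧ hessianForm f X D D ≤ 3 / 2 * c * ip D D)
    {U U' : Matrix (Fin p) (Fin r) ℝ} {V V' : Matrix (Fin q) (Fin r) ℝ}
    (h₁ : grad f (U * Vᵀ) * V = -(lam • U)) (h₂ : (grad f (U * Vᵀ))ᵀ * U = -(lam • V))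
    (h₁' : grad f (U' * V'ᵀ) * V' = -(lam • U')) (h₂' : (grad f (U' * V'ᵀ))ᵀ * U' = -(lam • V'))
    (hpos : 0 ≤ 2 * ip (grad f (U' * V'ᵀ)) (U * Vᵀ) + lam * (ip U U + ip V V))
    {T : Matrix (Fin r) (Fin r) ℝ}
    (hT : (Matrix.fromRows U V)ᵀ * Matrix.fromRows U' V' = Tᵀ * T) :
    hessianForm (factored f lam) (Matrix.fromRows U V)
        (Matrix.fromRows U V - Matrix.fromRows U' V')
        (Matrix.fromRows U V - Matrix.fromRows U' V') ≤
      -(47 / 100) * c * ip (U * Vᵀ - U' * V'ᵀ) (U * Vᵀ - U' * V'ᵀ) := by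
  have hbal := balanced_of_isCriticalPoint hlam h₁ h₂
  have hbal' := balanced_of_isCriticalPoint hlam h₁' h₂'
  obtain ⟨G, hG⟩ : ∃ G, G = grad f (U * Vᵀ) := ⟨_, rfl⟩
  obtain ⟨G', hG'⟩ : ∃ G', G' = grad f (U' * V'ᵀ) := ⟨_, rfl⟩
  obtain ⟨L, hL⟩ : ∃ L, L = U * Vᵀ - U' * V'ᵀ := ⟨_, rfl⟩
  obtain ⟨C, hC⟩ : ∃ C, C = Matrix.fromRows U V := ⟨_, rfl⟩
  obtain ⟨D, hD⟩ : ∃ D, D = Matrix.fromRows U' V' := ⟨_, rfl⟩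
  obtain ⟨N, hN, hN₁, hN₂⟩ := exists_gram_pseudoinverse C
  obtain ⟨E, hE⟩ : ∃ E, E = Dᵀ * (C * N) := ⟨_, rfl⟩
  have hpair₁ : ∀ (K : Matrix (Fin p) (Fin q) ℝ) (A : Matrix (Fin p) (Fin r) ℝ)
      (B : Matrix (Fin q) (Fin r) ℝ), ip K (A * Bᵀ) = ip (K * B) A := by
    intro K A B
    rw [ip_mul_right]
  have hpair₂ : ∀ (K : Matrix (Fin p) (Fin q) ℝ) (A : Matrix (Fin p) (Fin r) ℝ)
      (B : Matrix (Fin q) (Fin r) ℝ), ip K (A * Bᵀ) = ip (Kᵀ * A) B := by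
    intro K A B
    rw [ip_comm, ip_mul_left, ← ip_transpose, Matrix.transpose_transpose, Matrix.transpose_mul,
      Matrix.transpose_transpose, ip_comm]
  have k₁ : ∀ A : Matrix (Fin p) (Fin r) ℝ, ip G (A * Vᵀ) = -(lam * ip U A) := fun A => by
    rw [hpair₁, hG, h₁, ip_neg_left, ip_smul_left]
  have k₂ : ∀ B : Matrix (Fin q) (Fin r) ℝ, ip G (U * Bᵀ) = -(lam * ip V B) := fun B => by
    rw [hpair₂, hG, h₂, ip_neg_left, ip_smul_left]
  have k₁' : ∀ A : Matrix (Fin p) (Fin r) ℝ, ip G' (A * V'ᵀ) = -(lam * ip U' A) := fun A => by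
    rw [hpair₁, hG', h₁', ip_neg_left, ip_smul_left]
  have k₂' : ∀ B : Matrix (Fin q) (Fin r) ℝ, ip G' (U' * Bᵀ) = -(lam * ip V' B) := fun B => by
    rw [hpair₂, hG', h₂', ip_neg_left, ip_smul_left]
  rw [← hG'] at hpos
  have hL' : U' * V'ᵀ + L = U * Vᵀ := by rw [hL]; abel
  have hLrank : L.rank ≤ 2 * r := by
    have : L = U * Vᵀ + U' * (-V')ᵀ := by rw [hL]; simp [sub_eq_add_neg]
    rw [this]; exact rank_mul_add_mul_le _ _ _ _
  have hseg : ∀ t : ℝ, (U' * V'ᵀ + t • L).rank ≤ 2 * r := by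
    intro t
    have : U' * V'ᵀ + t • L = ((1 - t) • U') * V'ᵀ + (t • U) * Vᵀ := by
      rw [hL, Matrix.smul_mul, Matrix.smul_mul]; module
    rw [this]; exact rank_mul_add_mul_le _ _ _ _
  have hmono : c * ip L L ≤ ip (G - G') L := by
    rw [hG, hG', ← hL']
    exact le_ip_grad_sub hf _ _ _ _ fun t => (hwc _ _ (hseg t) (by omega)).1
  -- the projected difference of Gram matrices
  obtain ⟨P, hP⟩ : ∃ P, P = C * (N * Cᵀ) := ⟨_, rfl⟩
  have hPt : Pᵀ = P := by
    rw [hP]; simp only [Matrix.transpose_mul, Matrix.transpose_transpose, hN, Matrix.mul_assoc]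
  have hPC : P * C = C := by
    rw [hP]; simpa only [Matrix.mul_assoc] using hN₂
  have hPP : P * P = P := by
    calc P * P = P * C * (N * Cᵀ) := by rw [Matrix.mul_assoc, ← hP]
      _ = P := by rw [hPC, ← hP]
  have hCP : Cᵀ * P = Cᵀ := by
    have := congrArg Matrix.transpose hPC
    rwa [Matrix.transpose_mul, hPt] at this
  have hYP : (C * Cᵀ - D * Dᵀ) * P = (C - D * E) * Cᵀ := by
    rw [Matrix.sub_mul, Matrix.mul_assoc, hCP, Matrix.sub_mul, hP, hE]
    simp only [Matrix.mul_assoc]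
  obtain ⟨F₁, hF₁⟩ : ∃ F₁, F₁ = U - U' * E := ⟨_, rfl⟩
  obtain ⟨F₂, hF₂⟩ : ∃ F₂, F₂ = V - V' * E := ⟨_, rfl⟩
  obtain ⟨H, hH⟩ : ∃ H, H = F₁ * Vᵀ + U * F₂ᵀ := ⟨_, rfl⟩
  obtain ⟨z, hz⟩ : ∃ z, z = ip ((C * Cᵀ - D * Dᵀ) * P) ((C * Cᵀ - D * Dᵀ) * P) := ⟨_, rfl⟩
  have hF : C - D * E = Matrix.fromRows F₁ F₂ := by
    rw [hF₁, hF₂, hC, hD, Matrix.fromRows_mul]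
    ext i j
    rcases i with i | i <;> simp
  have hLH : z ≤ 2 * ip L H := by
    rw [hz, hH, hL, hF₁, hF₂]
    exact half_ip_projected_le hbal' hbal hC hD hPt hPP hYP
  have hHH : ip H H ≤ z := by
    rw [hz, hH, hYP]; exact ip_cross_le hbal hC hF
  -- The terms in `E` cancel by criticality of both pairs; what remains is minus the quantity in
  -- `hpos`.
  have hgrad : ip (G - G') H ≤ 0 := by
    have e1 : ip G' (U' * E * Vᵀ) = -(lam * ip V' (V * Eᵀ)) := by
      rw [← k₂', Matrix.transpose_mul, Matrix.transpose_transpose, Matrix.mul_assoc]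
    have e2 : ip G' (U * (V' * E)ᵀ) = -(lam * ip U' (U * Eᵀ)) := by
      rw [← k₁', Matrix.transpose_mul, Matrix.mul_assoc]
    have e3 : ip V' (V * Eᵀ) = ip V (V' * E) := by rw [ip_comm V, ip_mul_right]
    have e4 : ip U' (U * Eᵀ) = ip U (U' * E) := by rw [ip_comm U, ip_mul_right]
    have e5 : ip G' H = 2 * ip G' (U * Vᵀ) + lam * ip V (V' * E) + lam * ip U (U' * E) := by
      rw [hH, ip_add_right, hF₁, hF₂, Matrix.sub_mul, Matrix.transpose_sub, Matrix.mul_sub,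
        ip_sub_right, ip_sub_right, e1, e2, e3, e4]
      ring
    rw [ip_sub_left, e5, hH, ip_add_right, k₁, k₂, hF₁, hF₂, ip_sub_right, ip_sub_right]
    linarith
  have hHrank : H.rank ≤ 2 * r := by rw [hH]; exact rank_mul_add_mul_le _ _ _ _
  -- Inserting `z ≤ 2⟨L, H⟩` and `‖H‖² ≤ z` gives `5/8 z ≤ 1/20 ‖L‖² + 5/16 z`.
  have hz_le : z ≤ 4 / 25 * ip L L := by
    have h := le_ip_grad_sub hf (U' * V'ᵀ) L H _
      fun t => hessianForm_ge_of_restricted hf hwc (hseg t) hLrank hHrank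
    rw [hL', ← hG, ← hG'] at h
    have h' := h.trans hgrad
    have h'' : 5 / 4 * ip L H ≤ 1 / 8 * (2 / 5 * ip L L + 5 / 2 * ip H H) := by
      by_contra! hlt
      have := mul_pos hc (sub_pos.2 hlt)
      linarith
    linarith
  have hY : ip (C * Cᵀ - D * Dᵀ) (C * Cᵀ - D * Dᵀ) ≤ 4 * ip L L := by
    rw [hL]; exact balanced_gram_sub_le hbal hbal' hC hD
  have hΔ := sub_mul_transpose_le_projection C D T (by rw [hC, hD]; exact hT) P hPt hPP hPC
  rw [← hz] at hΔ
  have hsub : Matrix.fromRows U V - Matrix.fromRows U' V' =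
      Matrix.fromRows (U - U') (V - V') := by
    ext i j
    rcases i with i | i <;> simp
  have hcross : ip ((U - U') * Vᵀ + U * (V - V')ᵀ) ((U - U') * Vᵀ + U * (V - V')ᵀ) ≤
      ip (C * (C - D)ᵀ) (C * (C - D)ᵀ) := by
    have h := ip_cross_le (F₁ := U - U') (F₂ := V - V') hbal hC rfl
    rw [← hsub, ← hC, ← hD] at h
    rw [← ip_transpose (C * (C - D)ᵀ), Matrix.transpose_mul, Matrix.transpose_transpose]
    exact h
  have hXr : (U * Vᵀ).rank ≤ 2 * r := by
    have := hseg 1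
    rwa [one_smul, hL'] at this
  have hΦr : ((U - U') * Vᵀ + U * (V - V')ᵀ).rank ≤ 4 * r :=
    (rank_mul_add_mul_le _ _ _ _).trans (by omega)
  have hhess := (hwc _ _ hXr hΦr).2
  -- After expansion with the critical point equations, the gap between the two sides is the
  -- quantity in `hpos`.
  have hgg : 2 * ip G ((U - U') * (V - V')ᵀ) + lam * (ip (U - U') (U - U') + ip (V - V') (V - V')) ≤
      -2 * ip (G - G') L := by
    have g1 := k₁ U
    have g2 := k₂ V
    have g3 := k₁' U'
    have g4 := k₂' V'
    rw [hL, Matrix.transpose_sub, Matrix.sub_mul, Matrix.mul_sub, Matrix.mul_sub]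
    simp only [ip_sub_left, ip_sub_right, k₁ U', k₂ V', ip_comm U' U, ip_comm V' V]
    linarith
  rw [hsub, hessianForm_factored hf, ← hG, ← hL]
  -- The total is `3/2 (4/8 + 13/4 · 4/25) - 2 = 1.53 - 2 = -0.47`.
  have hmul := mul_le_mul_of_nonneg_left (hcross.trans (hΔ.trans (add_le_add
    (mul_le_mul_of_nonneg_left hY (by norm_num : (0 : ℝ) ≤ 1 / 8))
    (mul_le_mul_of_nonneg_left hz_le (by norm_num : (0 : ℝ) ≤ 13 / 4))))) hc.le
  linarith

end Descent

end LowRank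

end

/-! ### Eigenvalue bounds and the main theorem -/

theorem theorem2 (p q r : ℕ) (f : Matrix (Fin p) (Fin q) ℝ → ℝ) (lam m M : ℝ)
    (hlam : 0 < lam)
    (hf : ContDiff ℝ 2 f)
    (hwc : LowRank.RestrictedWellConditioned f r m M)
    (Xstar : Matrix (Fin p) (Fin q) ℝ)
    (hopt : ∀ X : Matrix (Fin p) (Fin q) ℝ,
      f Xstar + lam * LowRank.nuclearNorm Xstar ≤ f X + lam * LowRank.nuclearNorm X)
    (hr : Xstar.rank ≤ r)
    (U : Matrix (Fin p) (Fin r) ℝ) (V : Matrix (Fin q) (Fin r) ℝ)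
    (hcrit : LowRank.IsCriticalPoint (LowRank.factored f lam) (Matrix.fromRows U V)) :
    U * Vᵀ = Xstar ∨
      (LowRank.IsStrictSaddle (LowRank.factored f lam) (Matrix.fromRows U V) ∧
        LowRank.lambdaMin
            (LowRank.hessianMatrix (LowRank.factored f lam) (Matrix.fromRows U V)) ≤
          -0.12 * m *
            min (0.5 * LowRank.rho (Matrix.fromRows U V) ^ 2) (LowRank.rho Xstar) ∧
        (r = Xstar.rank →
          LowRank.lambdaMin
              (LowRank.hessianMatrix (LowRank.factored f lam) (Matrix.fromRows U V)) ≤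
            -0.099 * m * LowRank.rho Xstar) ∧
        (Matrix.fromRows U V = 0 →
          LowRank.lambdaMin
              (LowRank.hessianMatrix (LowRank.factored f lam) (Matrix.fromRows U V)) ≤
            -0.12 * m * LowRank.rho Xstar)) := by
  open LowRank in
  obtain ⟨hm, hMm, hwc⟩ := hwc
  have hM : M ≤ 3 / 2 * m := by
    rw [div_le_iff₀ hm] at hMm; linarith
  have hwc' : ∀ X D : Matrix (Fin p) (Fin q) ℝ, X.rank ≤ 2 * r → D.rank ≤ 4 * r →
      m * ip D D ≤ hessianForm f X D D ∧ hessianForm f X D D ≤ 3 / 2 * m * ip D D := by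
    intro X D hX hD
    obtain ⟨h1, h2⟩ := hwc X D hX hD
    rw [norm_sq_eq_ip] at h1 h2
    exact ⟨h1, h2.trans (mul_le_mul_of_nonneg_right hM (ip_self_nonneg D))⟩
  by_cases hne : U * Vᵀ = Xstar
  · exact Or.inl hne
  refine Or.inr ?_
  obtain ⟨U₀, V₀, hX₀, hU₀, hV₀, hnuc⟩ := exists_balanced_factorization Xstar hr
  obtain ⟨R, T, hR, hR', hRT⟩ := exists_orthogonal_mul_eq_gram
    ((Matrix.fromRows U V)ᵀ * Matrix.fromRows U₀ V₀)
  obtain ⟨h₁, h₂⟩ := grad_mul_of_isCriticalPoint hf hcrit.fderiv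
  obtain ⟨h₁', h₂'⟩ := grad_mul_of_isCriticalPoint hf
    (fderiv_factored_eq_zero_of_isMinimizer hlam.le hopt hX₀ hnuc)
  have hpos := ip_grad_nonneg_of_isMinimizer hf hlam.le hopt hX₀ hnuc U V
  have hXR : (U₀ * R) * (V₀ * R)ᵀ = Xstar := by
    rw [Matrix.transpose_mul, Matrix.mul_assoc, ← Matrix.mul_assoc R, hR', Matrix.one_mul, hX₀]
  have hDR : Matrix.fromRows (U₀ * R) (V₀ * R) = Matrix.fromRows U₀ V₀ * R :=
    (Matrix.fromRows_mul _ _ _).symm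
  have hT : (Matrix.fromRows U V)ᵀ * Matrix.fromRows (U₀ * R) (V₀ * R) = Tᵀ * T := by
    rw [hDR, ← Matrix.mul_assoc, hRT]
  rw [hX₀] at h₁' h₂'
  have hcurv := hessianForm_factored_sub_le hf hlam.ne' hm hwc' h₁ h₂
    (U' := U₀ * R) (V' := V₀ * R)
    (by rw [hXR, ← Matrix.mul_assoc, h₁', Matrix.neg_mul, Matrix.smul_mul])
    (by rw [hXR, ← Matrix.mul_assoc, h₂', Matrix.neg_mul, Matrix.smul_mul])
    (by rw [hXR]; exact hpos) hT
  have hY := balanced_gram_sub_le (balanced_of_isCriticalPoint hlam.ne' h₁ h₂)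
    (U' := U₀ * R) (V' := V₀ * R)
    (by rw [Matrix.transpose_mul, Matrix.transpose_mul, Matrix.mul_assoc, Matrix.mul_assoc,
          ← Matrix.mul_assoc U₀ᵀ, ← Matrix.mul_assoc V₀ᵀ, hU₀, hV₀]) rfl rfl
  rw [hXR] at hcurv hY
  have hLpos : 0 < ip (U * Vᵀ - Xstar) (U * Vᵀ - Xstar) := ip_self_pos (sub_ne_zero.2 hne)
  have hray := lambdaMin_hessianMatrix_mul_le (contDiff_factored (r := r) hf lam)
    (Matrix.fromRows U V) (Matrix.fromRows U V - Matrix.fromRows (U₀ * R) (V₀ * R))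
  obtain ⟨C, hC⟩ : ∃ C, C = Matrix.fromRows U V := ⟨_, rfl⟩
  obtain ⟨D, hD⟩ : ∃ D, D = Matrix.fromRows (U₀ * R) (V₀ * R) := ⟨_, rfl⟩
  obtain ⟨μ, hμ⟩ : ∃ μ, μ = lambdaMin (hessianMatrix (factored f lam) (Matrix.fromRows U V)) :=
    ⟨_, rfl⟩
  rw [← hμ] at hray ⊢
  rw [← hC, ← hD] at hray hT hcurv hY
  have hray' := hray.trans hcurv
  have hneg : μ * ip (C - D) (C - D) < 0 :=
    hray'.trans_lt (by nlinarith [mul_pos hm hLpos])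
  have hμ0 : μ < 0 := by
    by_contra! h
    exact absurd (mul_nonneg h (ip_self_nonneg (C - D))) (not_le.2 hneg)
  have hΔpos : 0 < ip (C - D) (C - D) := by
    refine lt_of_le_of_ne (ip_self_nonneg _) fun h => ?_
    rw [← h, mul_zero] at hneg
    exact lt_irrefl _ hneg
  -- a lower bound on the difference of Gram matrices gives an upper bound on the eigenvalue
  have hbound : ∀ ρ τ : ℝ, 0 ≤ ρ → 0 ≤ τ →
      τ * ρ * ip (C - D) (C - D) ≤ ip (C * Cᵀ - D * Dᵀ) (C * Cᵀ - D * Dᵀ) →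
      μ ≤ -(47 / 400) * τ * m * ρ := by
    intro ρ τ hρ hτ h
    refine le_of_mul_le_mul_right ?_ hΔpos
    -- `47/400` is the curvature constant `47/100` divided by the factor `4` in `hY`.
    have := mul_le_mul_of_nonneg_left (h.trans hY) hm.le
    linarith
  obtain ⟨O, hO, hO', hCO⟩ := exists_orthogonal_gram_eq_diagonal C
  have hsX : ∀ i, 0 ≤ singularValue Xstar i := fun i => singularValue_nonneg _ _
  -- Each balanced factor contributes `σᵢ(X⋆)`, so the squared singular values of the stack are
  -- `2σᵢ(X⋆)`.
  have hD₀ : (Matrix.fromRows U₀ V₀)ᵀ * Matrix.fromRows U₀ V₀ =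
      Matrix.diagonal fun i : Fin r => √(2 * singularValue Xstar i) ^ 2 := by
    rw [transpose_fromRows_mul_fromRows, hU₀, hV₀, Matrix.diagonal_add]
    congr 1
    ext i
    rw [Real.sq_sqrt (mul_nonneg zero_le_two (hsX _)), two_mul]
  have hgram : ∀ ρ : ℝ, 0 ≤ ρ →
      (∀ i : Fin r, singularValue C i ≠ 0 → ρ ≤ singularValue C i ^ 2) →
      ρ ≤ 2 * rho Xstar →
      ρ * ip (C - D) (C - D) ≤ ip (C * Cᵀ - D * Dᵀ) (C * Cᵀ - D * Dᵀ) := by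
    intro ρ hρ hρC hρX
    refine mul_ip_sub_le_gram_sub (O₁ := O) (O₂ := Rᵀ) hT hO hO' (by simpa using hR')
      (by simpa using hR) (C₀ := C * O) (D₀ := Matrix.fromRows U₀ V₀)
      (by rw [Matrix.mul_assoc, hO', Matrix.mul_one])
      (by rw [hD, hDR, Matrix.transpose_transpose]) hCO hD₀ (fun i => singularValue_nonneg _ _)
      (fun i => Real.sqrt_nonneg _) hρ hρC fun i hi => ?_
    rw [Real.sq_sqrt (mul_nonneg zero_le_two (hsX _))]
    refine hρX.trans (mul_le_mul_of_nonneg_left (rho_le_singularValue _ fun h => hi ?_) zero_le_two)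
    rw [h, mul_zero, Real.sqrt_zero]
  have hρX0 := rho_nonneg Xstar
  refine ⟨⟨hcrit, by rw [← hμ]; exact hμ0⟩, ?_, ?_, ?_⟩
  · rw [← hC]
    obtain ⟨ρ, hρ⟩ : ∃ ρ, ρ = min (0.5 * rho C ^ 2) (rho Xstar) := ⟨_, rfl⟩
    have hρ0 : 0 ≤ ρ := by rw [hρ]; positivity
    have hρ1 : ρ ≤ 0.5 * rho C ^ 2 := by rw [hρ]; exact min_le_left _ _
    have hρ2 : ρ ≤ rho Xstar := by rw [hρ]; exact min_le_right _ _
    rw [← hρ]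
    have h := hbound (2 * ρ) 1 (by positivity) zero_le_one (by
      rw [one_mul]
      refine hgram _ (by positivity) (fun i hi => ?_) (by linarith)
      have := pow_le_pow_left₀ (rho_nonneg C) (rho_le_singularValue C hi) 2
      linarith)
    have := mul_nonneg hm.le hρ0
    linarith
  · intro hrr
    -- When `r = r⋆`, the Gram matrix of `D` is invertible with eigenvalues at least `2ρ(X⋆)`. With
    -- the roles of `C` and `D` exchanged, no singular value of `C` enters.
    have h := hbound (2 * rho Xstar) (4 / 5) (by positivity) (by norm_num) ?_
    · have := mul_nonneg hm.le hρX0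
      linarith
    · have hT' : Dᵀ * C = Tᵀ * T := by
        have := congrArg Matrix.transpose hT
        simpa only [Matrix.transpose_mul, Matrix.transpose_transpose] using this
      have h1 := sub_mul_transpose_le_gram_sub D C T hT'
      have h2 : ip (D * Dᵀ - C * Cᵀ) (D * Dᵀ - C * Cᵀ) =
          ip (C * Cᵀ - D * Dᵀ) (C * Cᵀ - D * Dᵀ) := by
        rw [← neg_sub (C * Cᵀ), ip_neg_left, ip_neg_right, neg_neg]
      have h3 : ip (D - C) (D - C) = ip (C - D) (C - D) := by
        rw [← neg_sub C, ip_neg_left, ip_neg_right, neg_neg]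
      have h4 : 2 * rho Xstar * ip (D - C) (D - C) ≤ ip (D * (D - C)ᵀ) (D * (D - C)ᵀ) := by
        have hdiag := ip_diagonal_le ((D - C) * Rᵀ) (2 * rho Xstar)
          (d := fun i : Fin r => √(2 * singularValue Xstar i) ^ 2) fun i => by
            rw [Real.sq_sqrt (mul_nonneg zero_le_two (hsX _))]
            have hi : 0 < singularValue Xstar i :=
              (singularValue_pos_iff Xstar i).2 (hrr ▸ i.2)
            linarith [rho_le_singularValue Xstar hi.ne']
        have e1 : ip ((D - C) * Rᵀ) ((D - C) * Rᵀ) = ip (D - C) (D - C) := by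
          rw [ip_mul_right, Matrix.transpose_transpose, Matrix.mul_assoc, hR, Matrix.mul_one]
        have e2 : ip (D * (D - C)ᵀ) (D * (D - C)ᵀ) = ip ((D - C) * Rᵀ) ((D - C) * Rᵀ *
            Matrix.diagonal fun i : Fin r => √(2 * singularValue Xstar i) ^ 2) := by
          have hDC : D * (D - C)ᵀ = Matrix.fromRows U₀ V₀ * ((D - C) * Rᵀ)ᵀ := by
            rw [Matrix.transpose_mul, Matrix.transpose_transpose, ← Matrix.mul_assoc, ← hDR, ← hD]
          rw [hDC, ip_mul_mul_transpose, hD₀, ip_comm, ip_mul_left, Matrix.transpose_transpose]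
        rw [e2, ← e1]
        exact hdiag
      rw [← h2, ← h3]
      linarith
  · intro hW
    -- With `C = 0` there are no nonzero singular values of `C`, so only `X⋆` constrains `ρ`.
    have hC0 : C = 0 := hC.trans hW
    have h := hbound (2 * rho Xstar) 1 (by positivity) zero_le_one (by
      rw [one_mul]
      refine hgram _ (by positivity) (fun i hi => absurd ?_ hi) le_rfl
      rw [singularValue_eq_zero_of_rank_le]
      rw [hC0, Matrix.rank_zero]
      exact Nat.zero_le _)
    have := mul_nonneg hm.le hρX0
    linarith
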